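/- **Theorem (Algorithmic Typing).** Consider the following syntax, up to renaming of bound variables. Unannotated terms: $a ::= x \mid (a\ a') \mid \lambda x.a \mid 0 \mid (S\ a) \mid (R_{nat}\ a\ a'\ a'') \mid nil \mid (cons\ a\ a') \mid (R_{vec}\ a\ a'\ a'') \mid join$. Types: $\varphi ::= nat \mid \langle vec\ \varphi\ a\rangle \mid \Pi x{:}\varphi.\varphi' \mid \forall x{:}\varphi.\varphi' \mid a = a'$. Annotated terms: $t ::= x \mid (t\ t') \mid (t\ t')^- \mid \lambda x{:}\varphi.t \mid \lambda^- x{:}\varphi.t \mid 0 \mid (S\ t) \mid (R_{nat}\ x.\varphi\ t\ t'\ t'') \mid (nil\ \varphi) \mid (cons\ t\ t') \mid (R_{vec}\ x.y.\varphi\ t\ t'\ t'') \mid (join\ t\ t') \mid (cast\ x.\varphi\ t\ t')$. Reduction $\leadsto$ on unannotated terms is the closure under arbitrary contexts of $(\lambda x.a)\ a' \leadsto [a'/x]a$, $(R_{nat}\ a\ a'\ 0)\leadsto a$, $(R_{nat}\ a\ a'\ (S\ a''))\leadsto (a'\ a''\ (R_{nat}\ a\ a'\ a''))$, $(R_{vec}\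 a\ a'\ nil)\leadsto a$, $(R_{vec}\ a\ a'\ (cons\ a_1\ a''))\leadsto (a'\ a_1\ a''\ (R_{vec}\ a\ a'\ a''))$; and $a\downarrow a'$ means that there is $\hat a$ with $a\leadsto^*\hat a$ and $a'\leadsto^*\hat a$. The erasure $|t|$ of an annotated term is given by $|(t\ t')^-| = |t|$, $|\lambda^- x{:}\varphi.t| = |t|$, $|\lambda x{:}\varphi.t| = \lambda x.|t|$, $|(nil\ \varphi)| = nil$, $|(R_{nat}\ x.\varphi\ t\ t'\ t'')| = (R_{nat}\ |t|\ |t'|\ |t''|)$, $|(R_{vec}\ x.y.\varphi\ t\ t'\ t'')| = (R_{vec}\ |t|\ |t'|\ |t''|)$, $|(join\ t\ t')| = join$, $|(cast\ x.\varphi\ t\ t')| = |t'|$, and commutes with variables, application, $0$, $S$ and $cons$. A context $\Gamma$ is a finite ordered list of declarations $x{:}\varphi$ of distinct variables; it is *Ok* if the free variables of each type in it are declared earlier in the list. The judgment $\Gamma\Vdash t:\varphi$ is defined inductively by the rules * $\Gamma\Vdash x:\Gamma(x)$, $\ \Gamma\Vdash 0:nat$ and $\Gamma\Vdash (nil\ \varphi):\langle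 vec\ \varphi\ 0\rangle$, each if $\Gamma$ is Ok (and $x\in dom(\Gamma)$); * $\Gamma\Vdash (S\ t):nat$ if $\Gamma\Vdash t:nat$; * $\Gamma\Vdash (cons\ t\ t'):\langle vec\ \varphi\ (S\ l)\rangle$ if $\Gamma\Vdash t:\varphi$ and $\Gamma\Vdash t':\langle vec\ \varphi\ l\rangle$; * $\Gamma\Vdash \lambda x{:}\varphi'.t:\Pi x{:}\varphi'.\varphi$ if $\Gamma,x{:}\varphi'\Vdash t:\varphi$; * $\Gamma\Vdash \lambda^- x{:}\varphi'.t:\forall x{:}\varphi'.\varphi$ if $\Gamma,x{:}\varphi'\Vdash t:\varphi$ and $x\notin FV(|t|)$; * $\Gamma\Vdash (t\ t'):[|t'|/x]\varphi$ if $\Gamma\Vdash t:\Pi x{:}\varphi'.\varphi$ and $\Gamma\Vdash t':\varphi'$; * $\Gamma\Vdash (t\ t')^-:[|t'|/x]\varphi$ if $\Gamma\Vdash t:\forall x{:}\varphi'.\varphi$ and $\Gamma\Vdash t':\varphi'$; * $\Gamma\Vdash (join\ t\ t'):|t|=|t'|$ if $\Gamma\Vdash t:\varphi$, $\Gamma\Vdash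 t':\varphi'$ and $|t|\downarrow|t'|$; * $\Gamma\Vdash (cast\ x.\varphi\ t\ t'):[a'/x]\varphi$ if $\Gamma\Vdash t:a=a'$ and $\Gamma\Vdash t':[a/x]\varphi$; * $\Gamma\Vdash (R_{nat}\ x.\varphi\ t\ t'\ t''):[|t''|/x]\varphi$ if $\Gamma\Vdash t'':nat$, $\Gamma\Vdash t:[0/x]\varphi$ and $\Gamma\Vdash t':\Pi y{:}nat.\Pi u{:}[y/x]\varphi.[(S\ y)/x]\varphi$; * $\Gamma\Vdash (R_{vec}\ x.y.\varphi\ t\ t'\ t''):[l/x,|t''|/y]\varphi$ if $\Gamma\Vdash t'':\langle vec\ \varphi'\ l\rangle$, $\Gamma\Vdash t:[0/x,nil/y]\varphi$ and $\Gamma\Vdash t':\forall l{:}nat.\Pi z{:}\varphi'.\Pi v{:}\langle vec\ \varphi'\ l\rangle.\Pi u{:}[l/x,v/y]\varphi.[(S\ l)/x,(cons\ z\ v)/y]\varphi$. Then there is an algorithm (a total computable function) which, given any context $\Gamma$ and any annotated term $t$, either returns a type $\varphi$ such that $\Gamma\Vdash t:\varphi$, or reports that there is none, and in the latter case there is indeed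 no type $\varphi$ with $\Gamma\Vdash t:\varphi$. -/

import Mathlib

/-!
The type theory with natural numbers, length-indexed vectors, dependent products, implicit
products (intersection types) and equality types between untyped terms.  Everything is
represented with de Bruijn indices, so that syntactic identity modulo renaming of bound
variables is equality.
-/

namespace Tvec

/-! ### Unannotated terms -/

/-- Unannotated terms `a`; `lam` binds the index `0` of its body. -/
inductive Tm : Type
  | var (n : ℕ)
  | app (a b : Tm)
  | lam (a : Tm)
  | zero
  | succ (a : Tm)
  | recNat (a b c : Tm)
  | nil
  | cons (a b : Tm)
  | recVec (a b c : Tm)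
  | join

/-- The action of a renaming under one binder. -/
def liftRen (f : ℕ → ℕ) : ℕ → ℕ
  | 0 => 0
  | n + 1 => f n + 1

/-- Renaming of the free variables of a term. -/
def Tm.rename : (ℕ → ℕ) → Tm → Tm
  | f, .var n => .var (f n)
  | f, .app a b => .app (a.rename f) (b.rename f)
  | f, .lam a => .lam (a.rename (liftRen f))
  | _, .zero => .zero
  | f, .succ a => .succ (a.rename f)
  | f, .recNat a b c => .recNat (a.rename f) (b.rename f) (c.rename f)
  | _, .nil => .nil
  | f, .cons a b => .cons (a.rename f) (b.rename f)
  | f, .recVec a b c => .recVec (a.rename f) (b.rename f) (c.rename f)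
  | _, .join => .join

/-- `scons a s` sends the index `0` to `a` and `n + 1` to `s n`. -/
def scons (a : Tm) (s : ℕ → Tm) : ℕ → Tm
  | 0 => a
  | n + 1 => s n

/-- `shiftVar k` sends the index `n` to the variable `n + k`. -/
def shiftVar (k : ℕ) : ℕ → Tm := fun n => .var (n + k)

/-- The action of a substitution under one binder. -/
def liftSub (s : ℕ → Tm) : ℕ → Tm :=
  scons (.var 0) (fun n => (s n).rename (· + 1))

/-- Simultaneous capture-avoiding substitution in a term. -/
def Tm.subst : (ℕ → Tm) → Tm → Tm
  | s, .var n => s n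
  | s, .app a b => .app (a.subst s) (b.subst s)
  | s, .lam a => .lam (a.subst (liftSub s))
  | _, .zero => .zero
  | s, .succ a => .succ (a.subst s)
  | s, .recNat a b c => .recNat (a.subst s) (b.subst s) (c.subst s)
  | _, .nil => .nil
  | s, .cons a b => .cons (a.subst s) (b.subst s)
  | s, .recVec a b c => .recVec (a.subst s) (b.subst s) (c.subst s)
  | _, .join => .join

/-- `a.inst b` is `[b/x]a`, where `x` is the variable with index `0` in `a`. -/
def Tm.inst (a b : Tm) : Tm := a.subst (scons b (shiftVar 0))

/-- The variable with index `n` occurs free in the term. -/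
def Tm.Occurs : ℕ → Tm → Prop
  | n, .var m => m = n
  | n, .app a b => a.Occurs n ∨ b.Occurs n
  | n, .lam a => a.Occurs (n + 1)
  | _, .zero => False
  | n, .succ a => a.Occurs n
  | n, .recNat a b c => a.Occurs n ∨ b.Occurs n ∨ c.Occurs n
  | _, .nil => False
  | n, .cons a b => a.Occurs n ∨ b.Occurs n
  | n, .recVec a b c => a.Occurs n ∨ b.Occurs n ∨ c.Occurs n
  | _, .join => False

/-- One-step reduction: the compatible closure of the five reduction rules. -/
inductive Step : Tm → Tm → Prop
  | beta (a b : Tm) : Step (.app (.lam a) b) (a.inst b)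
  | recNat_zero (a b : Tm) : Step (.recNat a b .zero) a
  | recNat_succ (a b c : Tm) :
      Step (.recNat a b (.succ c)) (.app (.app b c) (.recNat a b c))
  | recVec_nil (a b : Tm) : Step (.recVec a b .nil) a
  | recVec_cons (a b c d : Tm) :
      Step (.recVec a b (.cons c d)) (.app (.app (.app b c) d) (.recVec a b d))
  | app_left {a a' : Tm} (b : Tm) : Step a a' → Step (.app a b) (.app a' b)
  | app_right (a : Tm) {b b' : Tm} : Step b b' → Step (.app a b) (.app a b')
  | lam {a a' : Tm} : Step a a' → Step (.lam a) (.lam a')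
  | succ {a a' : Tm} : Step a a' → Step (.succ a) (.succ a')
  | recNat_fst {a a' : Tm} (b c : Tm) : Step a a' → Step (.recNat a b c) (.recNat a' b c)
  | recNat_snd (a : Tm) {b b' : Tm} (c : Tm) : Step b b' → Step (.recNat a b c) (.recNat a b' c)
  | recNat_thd (a b : Tm) {c c' : Tm} : Step c c' → Step (.recNat a b c) (.recNat a b c')
  | cons_left {a a' : Tm} (b : Tm) : Step a a' → Step (.cons a b) (.cons a' b)
  | cons_right (a : Tm) {b b' : Tm} : Step b b' → Step (.cons a b) (.cons a b')
  | recVec_fst {a a' : Tm} (b c : Tm) : Step a a' → Step (.recVec a b c) (.recVec a' b c)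
  | recVec_snd (a : Tm) {b b' : Tm} (c : Tm) : Step b b' → Step (.recVec a b c) (.recVec a b' c)
  | recVec_thd (a b : Tm) {c c' : Tm} : Step c c' → Step (.recVec a b c) (.recVec a b c')

/-- Joinability: the two terms have a common reduct. -/
def Joinable (a b : Tm) : Prop :=
  ∃ c, Relation.ReflTransGen Step a c ∧ Relation.ReflTransGen Step b c

/-! ### Types and contexts -/

/-- Types: `nat`, `⟨vec φ a⟩`, `Π x : φ. ψ`, `∀ x : φ. ψ` and `a = b`.  In `pi φ ψ` and
`all φ ψ` the index `0` of `ψ` is bound. -/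
inductive Ty : Type
  | nat
  | vec (φ : Ty) (a : Tm)
  | pi (φ ψ : Ty)
  | all (φ ψ : Ty)
  | eq (a b : Tm)

/-- Renaming of the free variables of a type. -/
def Ty.rename : (ℕ → ℕ) → Ty → Ty
  | _, .nat => .nat
  | f, .vec φ a => .vec (φ.rename f) (a.rename f)
  | f, .pi φ ψ => .pi (φ.rename f) (ψ.rename (liftRen f))
  | f, .all φ ψ => .all (φ.rename f) (ψ.rename (liftRen f))
  | f, .eq a b => .eq (a.rename f) (b.rename f)

/-- Weakening of a type by `k` variables. -/
def Ty.weaken (k : ℕ) (φ : Ty) : Ty := φ.rename (· + k)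

/-- Simultaneous capture-avoiding substitution in a type. -/
def Ty.subst : (ℕ → Tm) → Ty → Ty
  | _, .nat => .nat
  | s, .vec φ a => .vec (φ.subst s) (a.subst s)
  | s, .pi φ ψ => .pi (φ.subst s) (ψ.subst (liftSub s))
  | s, .all φ ψ => .all (φ.subst s) (ψ.subst (liftSub s))
  | s, .eq a b => .eq (a.subst s) (b.subst s)

/-- `φ.inst a` is `[a/x]φ`, where `x` is the variable with index `0` in `φ`. -/
def Ty.inst (φ : Ty) (a : Tm) : Ty := φ.subst (scons a (shiftVar 0))

/-- `φ.inst₂ a b` is `[a/x, b/y]φ`, where `x` and `y` have the indices `1` and `0` in `φ`. -/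
def Ty.inst₂ (φ : Ty) (a b : Tm) : Ty := φ.subst (scons b (scons a (shiftVar 0)))

/-- The variable with index `n` occurs free in the type. -/
def Ty.Occurs : ℕ → Ty → Prop
  | _, .nat => False
  | n, .vec φ a => φ.Occurs n ∨ a.Occurs n
  | n, .pi φ ψ => φ.Occurs n ∨ ψ.Occurs (n + 1)
  | n, .all φ ψ => φ.Occurs n ∨ ψ.Occurs (n + 1)
  | n, .eq a b => a.Occurs n ∨ b.Occurs n

/-- Typing contexts.  The head of the list is the variable declared last (index `0`), and the
indices of each entry refer to the variables declared before it (the tail of the list). -/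
abbrev Ctx : Type := List Ty

/-- A context is in order if the free variables of each type are declared before it. -/
def Ctx.Ok : Ctx → Prop
  | [] => True
  | φ :: Γ => (∀ n, φ.Occurs n → n < Γ.length) ∧ Ctx.Ok Γ

/-! ### Annotated terms and type computation -/

/-- Annotated terms `t`.
* `app t u` is `(t u)` and `sapp t u` is `(t u)⁻`;
* `lam φ t` is `λ x : φ. t` and `slam φ t` is `λ⁻ x : φ. t` (one variable bound in `t`);
* `recNat φ t u v` is `(R_nat x.φ t u v)` (index `0` of `φ` bound);
* `recVec φ t u v` is `(R_vec x.y.φ t u v)` (in `φ`, `x` is the index `1`, `y` the index `0`);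
* `cast φ t u` is `(cast x.φ t u)` (index `0` of `φ` bound). -/
inductive ATm : Type
  | var (n : ℕ)
  | app (t u : ATm)
  | sapp (t u : ATm)
  | lam (φ : Ty) (t : ATm)
  | slam (φ : Ty) (t : ATm)
  | zero
  | succ (t : ATm)
  | recNat (φ : Ty) (t u v : ATm)
  | nil (φ : Ty)
  | cons (t u : ATm)
  | recVec (φ : Ty) (t u v : ATm)
  | join (t u : ATm)
  | cast (φ : Ty) (t u : ATm)

/-- Dropping the annotations.  In the clause for `λ⁻ x : φ. t`, the binder disappears, so the
indices of the dropped body are lowered by one.  This is meaningful if `x` is not free in the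
dropped body, which the typing rule for `λ⁻` demands; otherwise the value is irrelevant. -/
def ATm.drop : ATm → Tm
  | .var n => .var n
  | .app t u => .app t.drop u.drop
  | .sapp t _ => t.drop
  | .lam _ t => .lam t.drop
  | .slam _ t => t.drop.rename Nat.pred
  | .zero => .zero
  | .succ t => .succ t.drop
  | .recNat _ t u v => .recNat t.drop u.drop v.drop
  | .nil _ => .nil
  | .cons t u => .cons t.drop u.drop
  | .recVec _ t u v => .recVec t.drop u.drop v.drop
  | .join _ _ => .join
  | .cast _ _ u => u.drop

/-- The type `Π y : nat. Π u : [y/x]φ. [(S y)/x]φ` of the step function of `R_nat x.φ`. -/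
def natStepTy (φ : Ty) : Ty :=
  .pi .nat <|                                        -- y
  .pi (φ.subst (scons (.var 0) (shiftVar 1))) <|     -- u
  φ.subst (scons (.succ (.var 1)) (shiftVar 2))

/-- The type `∀ l : nat. Π z : ψ. Π v : ⟨vec ψ l⟩. Π u : [l/x, v/y]φ. [(S l)/x, (cons z v)/y]φ`
of the step function of `R_vec x.y.φ` for vectors with elements in `ψ`. -/
def vecStepTy (ψ φ : Ty) : Ty :=
  .all .nat <|                                                       -- l
  .pi (ψ.weaken 1) <|                                                -- z
  .pi (.vec (ψ.weaken 2) (.var 1)) <|                                -- v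
  .pi (φ.subst (scons (.var 0) (scons (.var 2) (shiftVar 3)))) <|    -- u
  φ.subst (scons (.cons (.var 2) (.var 1)) (scons (.succ (.var 3)) (shiftVar 4)))

/-- The type-computation judgment `Γ ⊩ t : φ` for annotated terms. -/
inductive HasType : Ctx → ATm → Ty → Prop
  | var {Γ : Ctx} {n : ℕ} {φ : Ty} :
      Ctx.Ok Γ → Γ[n]? = some φ → HasType Γ (.var n) (φ.weaken (n + 1))
  | join {Γ : Ctx} {t u : ATm} {φ ψ : Ty} :
      HasType Γ t φ → HasType Γ u ψ → Joinable t.drop u.drop →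
      HasType Γ (.join t u) (.eq t.drop u.drop)
  | cast {Γ : Ctx} {φ : Ty} {t u : ATm} {a b : Tm} :
      HasType Γ t (.eq a b) → HasType Γ u (φ.inst a) → HasType Γ (.cast φ t u) (φ.inst b)
  | slam {Γ : Ctx} {ψ φ : Ty} {t : ATm} :
      HasType (ψ :: Γ) t φ → ¬ t.drop.Occurs 0 → HasType Γ (.slam ψ t) (.all ψ φ)
  | sapp {Γ : Ctx} {ψ φ : Ty} {t u : ATm} :
      HasType Γ t (.all ψ φ) → HasType Γ u ψ → HasType Γ (.sapp t u) (φ.inst u.drop)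
  | lam {Γ : Ctx} {ψ φ : Ty} {t : ATm} :
      HasType (ψ :: Γ) t φ → HasType Γ (.lam ψ t) (.pi ψ φ)
  | app {Γ : Ctx} {ψ φ : Ty} {t u : ATm} :
      HasType Γ t (.pi ψ φ) → HasType Γ u ψ → HasType Γ (.app t u) (φ.inst u.drop)
  | zero {Γ : Ctx} : Ctx.Ok Γ → HasType Γ .zero .nat
  | succ {Γ : Ctx} {t : ATm} : HasType Γ t .nat → HasType Γ (.succ t) .nat
  | recNat {Γ : Ctx} {φ : Ty} {t u v : ATm} :
      HasType Γ v .nat → HasType Γ t (φ.inst .zero) → HasType Γ u (natStepTy φ) →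
      HasType Γ (.recNat φ t u v) (φ.inst v.drop)
  | nil {Γ : Ctx} {φ : Ty} : Ctx.Ok Γ → HasType Γ (.nil φ) (.vec φ .zero)
  | cons {Γ : Ctx} {φ : Ty} {l : Tm} {t u : ATm} :
      HasType Γ t φ → HasType Γ u (.vec φ l) → HasType Γ (.cons t u) (.vec φ (.succ l))
  | recVec {Γ : Ctx} {ψ φ : Ty} {l : Tm} {t u v : ATm} :
      HasType Γ v (.vec ψ l) → HasType Γ t (φ.inst₂ .zero .nil) →
      HasType Γ u (vecStepTy ψ φ) →
      HasType Γ (.recVec φ t u v) (φ.inst₂ l v.drop)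

/-! ### Codes

Explicit bijective numberings of the three syntactic categories, so that the notion of a
computable function applies to them: atoms get the first numbers, and a compound expression with
constructor tag `i` (out of `m`) gets `m * p + i` plus the number of atoms, where `p` is the
iterated Cantor-style pairing of the codes of its arguments. -/

/-- The code of a term. -/
def Tm.code : Tm → ℕ
  | .zero => 0
  | .nil => 1
  | .join => 2
  | .var n => 7 * n + 3
  | .app a b => 7 * Nat.pair a.code b.code + 4
  | .lam a => 7 * a.code + 5
  | .succ a => 7 * a.code + 6
  | .recNat a b c => 7 * Nat.pair a.code (Nat.pair b.code c.code) + 7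
  | .cons a b => 7 * Nat.pair a.code b.code + 8
  | .recVec a b c => 7 * Nat.pair a.code (Nat.pair b.code c.code) + 9

/-- The code of a type. -/
def Ty.code : Ty → ℕ
  | .nat => 0
  | .vec φ a => 4 * Nat.pair φ.code a.code + 1
  | .pi φ ψ => 4 * Nat.pair φ.code ψ.code + 2
  | .all φ ψ => 4 * Nat.pair φ.code ψ.code + 3
  | .eq a b => 4 * Nat.pair a.code b.code + 4

/-- The code of an annotated term. -/
def ATm.code : ATm → ℕ
  | .zero => 0
  | .var n => 12 * n + 1
  | .app t u => 12 * Nat.pair t.code u.code + 2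
  | .sapp t u => 12 * Nat.pair t.code u.code + 3
  | .lam φ t => 12 * Nat.pair φ.code t.code + 4
  | .slam φ t => 12 * Nat.pair φ.code t.code + 5
  | .succ t => 12 * t.code + 6
  | .recNat φ t u v => 12 * Nat.pair φ.code (Nat.pair t.code (Nat.pair u.code v.code)) + 7
  | .nil φ => 12 * φ.code + 8
  | .cons t u => 12 * Nat.pair t.code u.code + 9
  | .recVec φ t u v => 12 * Nat.pair φ.code (Nat.pair t.code (Nat.pair u.code v.code)) + 10
  | .join t u => 12 * Nat.pair t.code u.code + 11
  | .cast φ t u => 12 * Nat.pair φ.code (Nat.pair t.code u.code) + 12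

theorem exists_pair (k : ℕ) : ∃ a b, Nat.pair a b = k ∧ a ≤ k ∧ b ≤ k :=
  ⟨k.unpair.1, k.unpair.2, Nat.pair_unpair k, Nat.unpair_left_le k, Nat.unpair_right_le k⟩

theorem Tm.code_injective : Function.Injective Tm.code := by
  intro a
  induction a <;> intro b h <;> cases b <;> simp only [Tm.code] at h <;>
    first
    | omega
    | rfl
    | (have h' := Nat.eq_of_mul_eq_mul_left (by norm_num) (Nat.add_right_cancel h)
       try simp only [Nat.pair_eq_pair] at h'
       grind)

theorem Tm.code_surjective : Function.Surjective Tm.code := by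
  intro n
  induction n using Nat.strong_induction_on with
  | _ n ih =>
    by_cases hn : n < 3
    · interval_cases n
      exacts [⟨.zero, rfl⟩, ⟨.nil, rfl⟩, ⟨.join, rfl⟩]
    obtain ⟨k, i, hi, rfl⟩ : ∃ k i, i < 7 ∧ n = 7 * k + 3 + i :=
      ⟨(n - 3) / 7, (n - 3) % 7, by omega, by omega⟩
    obtain ⟨x, y, hxy, hx, hy⟩ := exists_pair k
    obtain ⟨z, w, hzw, hz, hw⟩ := exists_pair y
    obtain ⟨tk, hk⟩ := ih k (by omega)
    obtain ⟨a, ha⟩ := ih x (by omega)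
    obtain ⟨b, hb⟩ := ih y (by omega)
    obtain ⟨c, hc⟩ := ih z (by omega)
    obtain ⟨d, hd⟩ := ih w (by omega)
    interval_cases i
    · exact ⟨.var k, by simp [Tm.code]⟩
    · exact ⟨.app a b, by simp [Tm.code, *]⟩
    · exact ⟨.lam tk, by simp [Tm.code, *]⟩
    · exact ⟨.succ tk, by simp [Tm.code, *]⟩
    · exact ⟨.recNat a c d, by simp [Tm.code, *]⟩
    · exact ⟨.cons a b, by simp [Tm.code, *]⟩
    · exact ⟨.recVec a c d, by simp [Tm.code, *]⟩

theorem Ty.code_injective : Function.Injective Ty.code := by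
  have hT := @Tm.code_injective
  intro a
  induction a <;> intro b h <;> cases b <;> simp only [Ty.code] at h <;>
    first
    | omega
    | rfl
    | (have h' := Nat.eq_of_mul_eq_mul_left (by norm_num) (Nat.add_right_cancel h)
       try simp only [Nat.pair_eq_pair, hT.eq_iff] at h'
       grind)

theorem Ty.code_surjective : Function.Surjective Ty.code := by
  intro n
  induction n using Nat.strong_induction_on with
  | _ n ih =>
    by_cases hn : n < 1
    · interval_cases n
      exact ⟨.nat, rfl⟩
    obtain ⟨k, i, hi, rfl⟩ : ∃ k i, i < 4 ∧ n = 4 * k + 1 + i :=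
      ⟨(n - 1) / 4, (n - 1) % 4, by omega, by omega⟩
    obtain ⟨x, y, hxy, hx, hy⟩ := exists_pair k
    obtain ⟨φ, hφ⟩ := ih x (by omega)
    obtain ⟨ψ, hψ⟩ := ih y (by omega)
    obtain ⟨a, ha⟩ := Tm.code_surjective x
    obtain ⟨b, hb⟩ := Tm.code_surjective y
    interval_cases i
    · exact ⟨.vec φ b, by simp [Ty.code, *]⟩
    · exact ⟨.pi φ ψ, by simp [Ty.code, *]⟩
    · exact ⟨.all φ ψ, by simp [Ty.code, *]⟩
    · exact ⟨.eq a b, by simp [Ty.code, *]⟩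

theorem ATm.code_injective : Function.Injective ATm.code := by
  have hT := @Ty.code_injective
  intro a
  induction a <;> intro b h <;> cases b <;> simp only [ATm.code] at h <;>
    first
    | omega
    | rfl
    | (have h' := Nat.eq_of_mul_eq_mul_left (by norm_num) (Nat.add_right_cancel h)
       try simp only [Nat.pair_eq_pair, hT.eq_iff] at h'
       grind)

theorem ATm.code_surjective : Function.Surjective ATm.code := by
  intro n
  induction n using Nat.strong_induction_on with
  | _ n ih =>
    by_cases hn : n < 1
    · interval_cases n
      exact ⟨.zero, rfl⟩
    obtain ⟨k, i, hi, rfl⟩ : ∃ k i, i < 12 ∧ n = 12 * k + 1 + i :=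
      ⟨(n - 1) / 12, (n - 1) % 12, by omega, by omega⟩
    obtain ⟨x, y, hxy, hx, hy⟩ := exists_pair k
    obtain ⟨z, w, hzw, hz, hw⟩ := exists_pair y
    obtain ⟨p, q, hpq, hp, hq⟩ := exists_pair w
    obtain ⟨tk, hk⟩ := ih k (by omega)
    obtain ⟨tx, htx⟩ := ih x (by omega)
    obtain ⟨ty, hty⟩ := ih y (by omega)
    obtain ⟨tz, htz⟩ := ih z (by omega)
    obtain ⟨tw, htw⟩ := ih w (by omega)
    obtain ⟨tp, htp⟩ := ih p (by omega)
    obtain ⟨tq, htq⟩ := ih q (by omega)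
    obtain ⟨φ, hφ⟩ := Ty.code_surjective x
    obtain ⟨χ, hχ⟩ := Ty.code_surjective k
    interval_cases i
    · exact ⟨.var k, by simp [ATm.code]⟩
    · exact ⟨.app tx ty, by simp [ATm.code, *]⟩
    · exact ⟨.sapp tx ty, by simp [ATm.code, *]⟩
    · exact ⟨.lam φ ty, by simp [ATm.code, *]⟩
    · exact ⟨.slam φ ty, by simp [ATm.code, *]⟩
    · exact ⟨.succ tk, by simp [ATm.code, *]⟩
    · exact ⟨.recNat φ tz tp tq, by simp [ATm.code, *]⟩
    · exact ⟨.nil χ, by simp [ATm.code, *]⟩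
    · exact ⟨.cons tx ty, by simp [ATm.code, *]⟩
    · exact ⟨.recVec φ tz tp tq, by simp [ATm.code, *]⟩
    · exact ⟨.join tx ty, by simp [ATm.code, *]⟩
    · exact ⟨.cast φ tz tw, by simp [ATm.code, *]⟩

noncomputable instance : Primcodable Ty :=
  Primcodable.ofEquiv ℕ (Equiv.ofBijective Ty.code ⟨Ty.code_injective, Ty.code_surjective⟩)

noncomputable instance : Primcodable ATm :=
  Primcodable.ofEquiv ℕ (Equiv.ofBijective ATm.code ⟨ATm.code_injective, ATm.code_surjective⟩)

theorem Ty.encode_eq_code (φ : Ty) : Encodable.encode φ = φ.code := rfl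

theorem ATm.encode_eq_code (t : ATm) : Encodable.encode t = t.code := rfl

end Tvec

/-! The typing rules are syntax-directed: the outermost constructor of an annotated term fixes the
only rule that can end a derivation. There is no conversion rule, so the types in the premises have
to match syntactically. Structural recursion on the term therefore computes the type, and the
resulting function `infer` is sound (`hasType_of_infer`) and complete (`HasType.infer_eq`).

The one obstacle is the rule for `join`, whose side condition is joinability of untyped terms, and
those may have infinite reductions. But that rule also requires both terms to be typable, and the
erasure of a typable term is strongly normalizing in every context (`HasType.sn`). Each term has
finitely many one-step reducts, so both reduction graphs can be listed completely and compared
(`mem_joinTest`). Confluence is not needed. The order matters: the search is started only after both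
types have been found, since it may otherwise diverge.

Strong normalization is proved with reducibility candidates. The candidate `Ty.Red` of a type
ignores the terms inside the type, so it is invariant under substitution (`Ty.red_subst`). This
removes the type dependency: both types in a cast have the same candidate, an equality type is
interpreted by all strongly normalizing terms whether or not it holds, and an implicit product is
interpreted by its codomain because erasure forgets the argument. The fundamental lemma is
`HasType.red`.

Computability is meant in the sense of partial recursive functions on codes. `Partrec.wf_rec`
derives it for well-founded recursions from Kleene's recursion theorem. The step function is allowed
to be partial, which is what lets `computable_infer` use a joinability search that terminates only
on the inputs that occur. -/

/-! ### Computable functions: closure properties -/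

section Computability

variable {α β γ σ : Type} [Primcodable α] [Primcodable β] [Primcodable γ] [Primcodable σ]

-- The closure properties below are in pointwise form, so that `fun_prop` can discharge
-- computability goals by following the shape of the expression.
attribute [fun_prop] Computable

namespace Computable

@[fun_prop] theorem id_fun : Computable fun a : α => a := Computable.id

@[fun_prop] theorem const_fun (s : σ) : Computable fun _ : α => s := Computable.const s

@[fun_prop] theorem comp_fun {f : β → γ} {g : α → β} (hf : Computable f) (hg : Computable g) :
    Computable fun x => f (g x) := hf.comp hg

@[fun_prop] theorem pair_fun {f : α → β} {g : α → γ} (hf : Computable f) (hg : Computable g) :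
    Computable fun x => (f x, g x) := hf.pair hg

@[fun_prop] theorem fst_fun {f : α → β × γ} (hf : Computable f) : Computable fun x => (f x).1 :=
  Computable.fst.comp hf

@[fun_prop] theorem snd_fun {f : α → β × γ} (hf : Computable f) : Computable fun x => (f x).2 :=
  Computable.snd.comp hf

@[fun_prop] theorem some_fun {f : α → β} (hf : Computable f) :
    Computable fun x => some (f x) := Computable.option_some.comp hf

@[fun_prop] theorem bind_fun {f : α → Option β} {g : α → β → Option γ} (hf : Computable f)
    (hg : Computable fun p : α × β => g p.1 p.2) : Computable fun x => (f x).bind (g x) :=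
  Computable.option_bind hf hg

@[fun_prop] theorem getD_fun {f : α → Option β} {g : α → β} (hf : Computable f)
    (hg : Computable g) : Computable fun x => (f x).getD (g x) := Computable.option_getD hf hg

@[fun_prop] theorem cons_fun {f : α → β} {g : α → List β} (hf : Computable f)
    (hg : Computable g) : Computable fun x => f x :: g x := Computable.list_cons.comp hf hg

@[fun_prop] theorem append_fun {f g : α → List β} (hf : Computable f)
    (hg : Computable g) : Computable fun x => f x ++ g x := Computable.list_append.comp hf hg

@[fun_prop] theorem length_fun {f : α → List β} (hf : Computable f) :
    Computable fun x => (f x).length := Computable.list_length.comp hf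

@[fun_prop] theorem getElem?_fun {f : α → List β} {g : α → ℕ} (hf : Computable f)
    (hg : Computable g) : Computable fun x => (f x)[g x]? := Computable.list_getElem?.comp hf hg

@[fun_prop] theorem tail_fun {f : α → List β} (hf : Computable f) :
    Computable fun x => (f x).tail := Primrec.list_tail.to_comp.comp hf

@[fun_prop] theorem cond_fun {c : α → Bool} {f g : α → σ} (hc : Computable c) (hf : Computable f)
    (hg : Computable g) : Computable fun x => bif c x then f x else g x := Computable.cond hc hf hg

@[fun_prop] theorem add_fun {f g : α → ℕ} (hf : Computable f) (hg : Computable g) :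
    Computable fun x => f x + g x := Primrec.nat_add.to_comp.comp hf hg

@[fun_prop] theorem sub_fun {f g : α → ℕ} (hf : Computable f) (hg : Computable g) :
    Computable fun x => f x - g x := Primrec.nat_sub.to_comp.comp hf hg

@[fun_prop] theorem mul_fun {f g : α → ℕ} (hf : Computable f) (hg : Computable g) :
    Computable fun x => f x * g x := Primrec.nat_mul.to_comp.comp hf hg

@[fun_prop] theorem div_fun {f g : α → ℕ} (hf : Computable f) (hg : Computable g) :
    Computable fun x => f x / g x := Primrec.nat_div.to_comp.comp hf hg

@[fun_prop] theorem mod_fun {f g : α → ℕ} (hf : Computable f) (hg : Computable g) :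
    Computable fun x => f x % g x := Primrec.nat_mod.to_comp.comp hf hg

@[fun_prop] theorem natPair_fun {f g : α → ℕ} (hf : Computable f) (hg : Computable g) :
    Computable fun x => Nat.pair (f x) (g x) := Primrec₂.natPair.to_comp.comp hf hg

@[fun_prop] theorem unpair_fun {f : α → ℕ} (hf : Computable f) :
    Computable fun x => Nat.unpair (f x) := Computable.unpair.comp hf

@[fun_prop] theorem beq_fun {f g : α → ℕ} (hf : Computable f) (hg : Computable g) :
    Computable fun x => f x == g x :=
  (Primrec.beq (α := ℕ)).to_comp.comp hf hg

@[fun_prop] theorem and_fun {f g : α → Bool} (hf : Computable f) (hg : Computable g) :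
    Computable fun x => f x && g x := Primrec.and.to_comp.comp hf hg

end Computable

/-! ### Well-founded recursion -/

open Nat.Partrec (Code)
open Encodable

/-- Tries to evaluate a program on a list of inputs within `k` steps. -/
def evalList (α σ : Type) [Primcodable α] [Primcodable σ] (p : ℕ × Code) (l : List α) :
    Option (List σ) :=
  l.foldr (fun b acc => (Code.evaln p.1 p.2 (encode b)).bind fun n =>
    (decode (α := σ) n).bind fun s => acc.bind fun t => some (s :: t)) (some [])

theorem primrec_evalList : Primrec₂ (evalList α σ) := by
  unfold evalList
  refine Primrec.list_foldr (α := (ℕ × Code) × List α)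
    (h := fun q b => (Code.evaln q.1.1 q.1.2 (encode b.1)).bind fun n =>
      (decode (α := σ) n).bind fun s => b.2.bind fun t => some (s :: t)) Primrec.snd
          (Primrec.const (some ([] : List σ))) ?_
  refine Primrec.option_bind (Nat.Partrec.Code.primrec_evaln.comp
    (Primrec.pair (Primrec.fst.comp Primrec.fst)
      (Primrec.encode.comp (Primrec.fst.comp Primrec.snd)))) ?_
  refine Primrec.option_bind (Primrec.decode.comp Primrec.snd) ?_
  refine Primrec.option_bind (Primrec.snd.comp (Primrec.snd.comp (Primrec.fst.comp Primrec.fst))) ?_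
  exact Primrec.option_some.comp
    (Primrec.list_cons.comp (Primrec.snd.comp Primrec.fst) Primrec.snd)

/-- A bounded run that succeeds agrees with unbounded evaluation, so the budget cannot influence the
result. Correctness of the program is assumed on the members of the list only, because an induction
hypothesis about recursive calls gives no more. -/
theorem evalList_eq_some {f : α → σ} {c : Code} {k : ℕ} :
    ∀ {l : List α} {t : List σ}, (∀ b ∈ l, c.eval (encode b) = Part.some (encode (f b))) →
      evalList α σ (k, c) l = some t → t = l.map f
  | [], t, _, h => by simpa [evalList, eq_comm] using h
  | b :: l, t, hl, h => by
    simp only [evalList, List.foldr_cons, Option.bind_eq_some_iff] at h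
    obtain ⟨n, hn, s, hs, t', ht', h⟩ := h
    have h1 := Code.evaln_sound hn
    rw [hl b (by simp), Part.mem_some_iff] at h1
    subst h1
    have h2 := evalList_eq_some (t := t') (fun b hb => hl b (by simp [hb])) ht'
    simp only [encodek, Option.some.injEq] at hs h
    simp [← h, ← hs, h2]

/-- Bounded evaluation is monotone in the budget, so the maximum of the budgets for the entries
serves all of them. -/
theorem exists_evalList {f : α → σ} {c : Code} :
    ∀ {l : List α}, (∀ b ∈ l, c.eval (encode b) = Part.some (encode (f b))) →
      ∃ k₀, ∀ k ≥ k₀, evalList α σ (k, c) l = some (l.map f)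
  | [], _ => ⟨0, fun _ _ => rfl⟩
  | b :: l, hl => by
    obtain ⟨k₁, h₁⟩ := exists_evalList (l := l) fun b hb => hl b (by simp [hb])
    obtain ⟨k₂, h₂⟩ := Code.evaln_complete.1 (by rw [hl b (by simp)]; exact Part.mem_some _ :
      encode (f b) ∈ c.eval (encode b))
    refine ⟨max k₁ k₂, fun k hk => ?_⟩
    have h3 := Code.evaln_mono (le_trans (le_max_right _ _) hk) h₂
    have h4 := h₁ k (le_trans (le_max_left _ _) hk)
    simp only [evalList, Option.mem_def] at h3 h4
    simp [evalList, h3, h4]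

/-- A function that is determined by well-founded recursion is computable if the list of the
arguments of the recursive calls and the combination of the results are computable. -/
theorem Partrec.wf_rec {r : α → α → Prop} (hr : WellFounded r) {f : α → σ} {next : α → List α}
    {step : α × List σ →. σ} (hn : Computable next) (hs : Partrec step)
    (hlt : ∀ a, ∀ b ∈ next a, r b a) (hf : ∀ a, f a ∈ step (a, (next a).map f)) :
    Computable f := by
  -- One unfolding of the recursion, with the program `c` standing in for `f`: search for a budget
  -- within which `c` answers all recursive calls, then combine the answers.
  let G : Code → α →. σ := fun c a =>
    (Nat.rfindOpt fun k => evalList α σ (k, c) (next a)).bind fun l => step (a, l)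
  have hG : Partrec₂ G := by
    refine Partrec.bind (Partrec.rfindOpt ?_) ?_
    · exact primrec_evalList.to_comp.comp
        (Computable.snd.pair (Computable.fst.comp Computable.fst))
        (hn.comp (Computable.snd.comp Computable.fst))
    · exact hs.comp ((Computable.snd.comp Computable.fst).pair Computable.snd)
  let F : Code → ℕ →. ℕ := fun c n =>
    Part.bind (↑(decode (α := α) n) : Part α) fun a => (G c a).map encode
  have hF : Partrec₂ F := by
    refine Partrec.bind (Computable.ofOption (Computable.decode.comp Computable.snd)) ?_
    exact Partrec.map (hG.comp (Computable.fst.comp Computable.fst) Computable.snd)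
      (Computable.encode.comp Computable.snd)
  -- Kleene's second recursion theorem: `c` computes the unfolding that calls `c` itself. Induction
  -- along `r` then shows that it halts with the value of `f`.
  obtain ⟨c, hc⟩ := Code.fixed_point₂ hF
  have key : ∀ a, c.eval (encode a) = Part.some (encode (f a)) := by
    intro a
    induction a using hr.induction with
    | _ a ih =>
      have ih' : ∀ b ∈ next a, c.eval (encode b) = Part.some (encode (f b)) :=
        fun b hb => ih b (hlt a b hb)
      obtain ⟨k, hk⟩ := exists_evalList (f := f) ih'
      have h1 : (next a).map f ∈ Nat.rfindOpt fun k => evalList α σ (k, c) (next a) := by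
        have hd := (Nat.rfindOpt_dom (f := fun k => evalList α σ (k, c) (next a))).2
          ⟨k, _, hk k le_rfl⟩
        obtain ⟨m, hm⟩ := Nat.rfindOpt_spec (Part.get_mem hd)
        -- The search may stop at a budget other than `k`; the list found is the same.
        have := evalList_eq_some ih' hm
        rw [← this]
        exact Part.get_mem hd
      have h2 : f a ∈ G c a := Part.mem_bind h1 (hf a)
      rw [hc, Part.eq_some_iff]
      simp only [F, encodek, Part.coe_some, Part.bind_some]
      exact Part.mem_map _ h2
  have hp : Partrec fun a : α =>
      (c.eval (encode a)).bind fun n => (↑(decode (α := σ) n) : Part σ) :=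
    Partrec.bind (Code.eval_part.comp (Computable.const c) Computable.encode)
      (Computable.ofOption (Computable.decode.comp Computable.snd))
  exact hp.of_eq fun a => by simp [key]

theorem Computable.wf_rec {r : α → α → Prop} (hr : WellFounded r) {f : α → σ}
    {next : α → List α} {step : α × List σ → σ} (hn : Computable next) (hs : Computable step)
    (hlt : ∀ a, ∀ b ∈ next a, r b a) (hf : ∀ a, f a = step (a, (next a).map f)) :
    Computable f :=
  Partrec.wf_rec hr hn hs hlt fun a => by simp [← hf]

@[fun_prop] theorem Computable.list_elim_fun {f : α → List β} {g : α → σ}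
    {h : α → β → List β → σ} (hf : Computable f) (hg : Computable g)
    (hh : Computable fun p : α × β × List β => h p.1 p.2.1 p.2.2) :
    Computable fun x => List.casesOn (motive := fun _ => σ) (f x) (g x) (h x) := by
  have h1 : Computable fun x => ((f x)[0]?).bind fun b => some (h x b (f x).tail) := by fun_prop
  exact (Computable.option_getD h1 hg).of_eq fun x => by cases f x <;> simp

@[fun_prop] theorem Computable.map_fun {f : α → List β} {g : α → β → σ} (hf : Computable f)
    (hg : Computable fun p : α × β => g p.1 p.2) : Computable fun x => (f x).map (g x) := by
  have : Computable fun p : α × List β => p.2.map (g p.1) := by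
    -- The parameter of `g` travels along with the list, since every recursive call needs it.
    refine Computable.wf_rec (InvImage.wf (fun p : α × List β => p.2.length) Nat.lt_wfRel.wf)
      (next := fun p => List.casesOn (motive := fun _ => List (α × List β)) p.2 [] fun _ l =>
          [(p.1, l)])
      (step := fun q => List.casesOn (motive := fun _ => List σ) q.1.2 []
        fun b _ => g q.1.1 b :: (q.2[0]?).getD []) (by fun_prop) ?_ ?_ ?_
    · fun_prop
    · rintro ⟨a, _ | ⟨b, l⟩⟩ <;> simp [InvImage, WellFoundedRelation.rel]
    · rintro ⟨a, _ | ⟨b, l⟩⟩ <;> simp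
  exact this.comp (Computable.id.pair hf)

@[fun_prop] theorem Computable.flatMap_fun {f : α → List β} {g : α → β → List σ}
    (hf : Computable f) (hg : Computable fun p : α × β => g p.1 p.2) :
    Computable fun x => (f x).flatMap (g x) := by
  exact (Primrec.list_flatten.to_comp.comp (Computable.map_fun hf hg)).of_eq fun x => by
    simp [List.flatMap]

end Computability

namespace Tvec

/-! ### Constructors and case distinction on codes -/

section Computability

variable {α σ : Type} [Primcodable α] [Primcodable σ]

noncomputable instance : Primcodable Tm :=
  Primcodable.ofEquiv ℕ (Equiv.ofBijective Tm.code ⟨Tm.code_injective, Tm.code_surjective⟩)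

/-- The term with a given code. -/
noncomputable def Tm.ofCode (n : ℕ) : Tm :=
  (Equiv.ofBijective Tm.code ⟨Tm.code_injective, Tm.code_surjective⟩).symm n

@[simp] theorem Tm.ofCode_code (a : Tm) : Tm.ofCode a.code = a :=
  Equiv.ofBijective_symm_apply_apply _ _ a

@[fun_prop] theorem Tm.computable_ofCode {f : α → ℕ} (hf : Computable f) :
    Computable fun x => Tm.ofCode (f x) :=
  Primrec.of_equiv_symm.to_comp.comp hf

@[fun_prop] theorem Tm.computable_code {f : α → Tm} (hf : Computable f) :
    Computable fun x => (f x).code := Computable.encode.comp hf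

/-- The encoding of a term is its code, so computability of a constructor reduces to arithmetic on
natural numbers. -/
theorem Tm.computable_of_code {f : α → Tm} (hf : Computable fun x => (f x).code) :
    Computable f := Computable.encode_iff.1 hf

/-- The type with a given code. -/
noncomputable def Ty.ofCode (n : ℕ) : Ty :=
  (Equiv.ofBijective Ty.code ⟨Ty.code_injective, Ty.code_surjective⟩).symm n

@[simp] theorem Ty.ofCode_code (a : Ty) : Ty.ofCode a.code = a :=
  Equiv.ofBijective_symm_apply_apply _ _ a

@[fun_prop] theorem Ty.computable_ofCode {f : α → ℕ} (hf : Computable f) :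
    Computable fun x => Ty.ofCode (f x) :=
  Primrec.of_equiv_symm.to_comp.comp hf

@[fun_prop] theorem Ty.computable_code {f : α → Ty} (hf : Computable f) :
    Computable fun x => (f x).code := Computable.encode.comp hf

theorem Ty.computable_of_code {f : α → Ty} (hf : Computable fun x => (f x).code) :
    Computable f := Computable.encode_iff.1 hf

/-- The annotated term with a given code. -/
noncomputable def ATm.ofCode (n : ℕ) : ATm :=
  (Equiv.ofBijective ATm.code ⟨ATm.code_injective, ATm.code_surjective⟩).symm n

@[simp] theorem ATm.ofCode_code (a : ATm) : ATm.ofCode a.code = a :=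
  Equiv.ofBijective_symm_apply_apply _ _ a

@[fun_prop] theorem ATm.computable_ofCode {f : α → ℕ} (hf : Computable f) :
    Computable fun x => ATm.ofCode (f x) :=
  Primrec.of_equiv_symm.to_comp.comp hf

@[fun_prop] theorem ATm.computable_code {f : α → ATm} (hf : Computable f) :
    Computable fun x => (f x).code := Computable.encode.comp hf

@[fun_prop] theorem Tm.computable_var {f : α → ℕ} (hf : Computable f) :
    Computable fun x => Tm.var (f x) :=
  Tm.computable_of_code (by simp only [Tm.code]; fun_prop)

@[fun_prop] theorem Tm.computable_app {f : α → Tm} {g : α → Tm} (hf : Computable f) (hg :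
    Computable g) :
    Computable fun x => Tm.app (f x) (g x) :=
  Tm.computable_of_code (by simp only [Tm.code]; fun_prop)

@[fun_prop] theorem Tm.computable_lam {f : α → Tm} (hf : Computable f) :
    Computable fun x => Tm.lam (f x) :=
  Tm.computable_of_code (by simp only [Tm.code]; fun_prop)

@[fun_prop] theorem Tm.computable_succ {f : α → Tm} (hf : Computable f) :
    Computable fun x => Tm.succ (f x) :=
  Tm.computable_of_code (by simp only [Tm.code]; fun_prop)

@[fun_prop] theorem Tm.computable_recNat {f : α → Tm} {g : α → Tm} {h : α → Tm} (hf : Computable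
    f) (hg : Computable g) (hh : Computable h) :
    Computable fun x => Tm.recNat (f x) (g x) (h x) :=
  Tm.computable_of_code (by simp only [Tm.code]; fun_prop)

@[fun_prop] theorem Tm.computable_cons {f : α → Tm} {g : α → Tm} (hf : Computable f) (hg :
    Computable g) :
    Computable fun x => Tm.cons (f x) (g x) :=
  Tm.computable_of_code (by simp only [Tm.code]; fun_prop)

@[fun_prop] theorem Tm.computable_recVec {f : α → Tm} {g : α → Tm} {h : α → Tm} (hf : Computable
    f) (hg : Computable g) (hh : Computable h) :
    Computable fun x => Tm.recVec (f x) (g x) (h x) :=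
  Tm.computable_of_code (by simp only [Tm.code]; fun_prop)

/-- Case distinction on the constructor, without dependent types. -/
def Tm.elim {σ : Type} (hzero : σ) (hnil : σ) (hjoin : σ) (hvar : ℕ → σ) (happ : Tm → Tm → σ)
    (hlam : Tm → σ) (hsucc : Tm → σ) (hrecNat : Tm → Tm → Tm → σ) (hcons : Tm → Tm → σ) (hrecVec :
    Tm → Tm → Tm → σ) : Tm → σ
  | .zero => hzero
  | .nil => hnil
  | .join => hjoin
  | .var x => hvar x
  | .app x y => happ x y
  | .lam x => hlam x
  | .succ x => hsucc x
  | .recNat x y z => hrecNat x y z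
  | .cons x y => hcons x y
  | .recVec x y z => hrecVec x y z

-- Past the three atoms, the remainder of `code - 3` modulo `7` is the constructor tag and the
-- quotient encodes the arguments.
@[fun_prop] theorem Tm.computable_elim {s : α → Tm}
    {hzero : α → σ}
    {hnil : α → σ}
    {hjoin : α → σ}
    {hvar : α → ℕ → σ}
    {happ : α → Tm → Tm → σ}
    {hlam : α → Tm → σ}
    {hsucc : α → Tm → σ}
    {hrecNat : α → Tm → Tm → Tm → σ}
    {hcons : α → Tm → Tm → σ}
    {hrecVec : α → Tm → Tm → Tm → σ}
    (hs : Computable s)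
    (hzero' : Computable hzero)
    (hnil' : Computable hnil)
    (hjoin' : Computable hjoin)
    (hvar' : Computable fun p : α × ℕ => hvar p.1 p.2)
    (happ' : Computable fun p : α × Tm × Tm => happ p.1 p.2.1 p.2.2)
    (hlam' : Computable fun p : α × Tm => hlam p.1 p.2)
    (hsucc' : Computable fun p : α × Tm => hsucc p.1 p.2)
    (hrecNat' : Computable fun p : α × Tm × Tm × Tm => hrecNat p.1 p.2.1 p.2.2.1 p.2.2.2)
    (hcons' : Computable fun p : α × Tm × Tm => hcons p.1 p.2.1 p.2.2)
    (hrecVec' : Computable fun p : α × Tm × Tm × Tm => hrecVec p.1 p.2.1 p.2.2.1 p.2.2.2)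
    : Computable fun x => Tm.elim (hzero x) (hnil x) (hjoin x) (hvar x) (happ x) (hlam x) (hsucc
        x) (hrecNat x) (hcons x) (hrecVec x) (s x) := by
  -- Each branch is evaluated at arguments decoded as if its constructor were present. For other
  -- constructors these are meaningless but still defined.
  have evar : Computable fun x => hvar x (((s x).code - 3) / 7) :=
    Computable.comp_fun (g := fun x => (x, (((s x).code - 3) / 7))) hvar' (by fun_prop)
  have eapp : Computable fun x => happ x (Tm.ofCode (Nat.unpair (((s x).code - 3) / 7)).1)
      (Tm.ofCode (Nat.unpair (((s x).code - 3) / 7)).2) :=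
    Computable.comp_fun (g := fun x => (x, (Tm.ofCode (Nat.unpair (((s x).code - 3) / 7)).1),
        (Tm.ofCode (Nat.unpair (((s x).code - 3) / 7)).2))) happ' (by fun_prop)
  have elam : Computable fun x => hlam x (Tm.ofCode (((s x).code - 3) / 7)) :=
    Computable.comp_fun (g := fun x => (x, (Tm.ofCode (((s x).code - 3) / 7)))) hlam' (by fun_prop)
  have esucc : Computable fun x => hsucc x (Tm.ofCode (((s x).code - 3) / 7)) :=
    Computable.comp_fun (g := fun x => (x, (Tm.ofCode (((s x).code - 3) / 7)))) hsucc' (by fun_prop)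
  have erecNat : Computable fun x => hrecNat x (Tm.ofCode (Nat.unpair (((s x).code - 3) / 7)).1)
      (Tm.ofCode (Nat.unpair ((Nat.unpair (((s x).code - 3) / 7)).2)).1) (Tm.ofCode (Nat.unpair
      ((Nat.unpair (((s x).code - 3) / 7)).2)).2) :=
    Computable.comp_fun (g := fun x => (x, (Tm.ofCode (Nat.unpair (((s x).code - 3) / 7)).1),
        (Tm.ofCode (Nat.unpair ((Nat.unpair (((s x).code - 3) / 7)).2)).1), (Tm.ofCode (Nat.unpair
        ((Nat.unpair (((s x).code - 3) / 7)).2)).2))) hrecNat' (by fun_prop)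
  have econs : Computable fun x => hcons x (Tm.ofCode (Nat.unpair (((s x).code - 3) / 7)).1)
      (Tm.ofCode (Nat.unpair (((s x).code - 3) / 7)).2) :=
    Computable.comp_fun (g := fun x => (x, (Tm.ofCode (Nat.unpair (((s x).code - 3) / 7)).1),
        (Tm.ofCode (Nat.unpair (((s x).code - 3) / 7)).2))) hcons' (by fun_prop)
  have erecVec : Computable fun x => hrecVec x (Tm.ofCode (Nat.unpair (((s x).code - 3) / 7)).1)
      (Tm.ofCode (Nat.unpair ((Nat.unpair (((s x).code - 3) / 7)).2)).1) (Tm.ofCode (Nat.unpair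
      ((Nat.unpair (((s x).code - 3) / 7)).2)).2) :=
    Computable.comp_fun (g := fun x => (x, (Tm.ofCode (Nat.unpair (((s x).code - 3) / 7)).1),
        (Tm.ofCode (Nat.unpair ((Nat.unpair (((s x).code - 3) / 7)).2)).1), (Tm.ofCode (Nat.unpair
        ((Nat.unpair (((s x).code - 3) / 7)).2)).2))) hrecVec' (by fun_prop)
  -- The atoms have to be tested first: truncated subtraction sends their codes to `0`, which
  -- carries the tag of a variable.
  have : Computable fun x =>
      bif (s x).code == 0 then hzero x else
      bif (s x).code == 1 then hnil x else
      bif (s x).code == 2 then hjoin x else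
      bif ((s x).code - 3) % 7 == 0 then hvar x (((s x).code - 3) / 7) else
      bif ((s x).code - 3) % 7 == 1 then happ x (Tm.ofCode (Nat.unpair (((s x).code - 3) / 7)).1)
          (Tm.ofCode (Nat.unpair (((s x).code - 3) / 7)).2) else
      bif ((s x).code - 3) % 7 == 2 then hlam x (Tm.ofCode (((s x).code - 3) / 7)) else
      bif ((s x).code - 3) % 7 == 3 then hsucc x (Tm.ofCode (((s x).code - 3) / 7)) else
      bif ((s x).code - 3) % 7 == 4 then hrecNat x (Tm.ofCode (Nat.unpair (((s x).code - 3) /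
          7)).1) (Tm.ofCode (Nat.unpair ((Nat.unpair (((s x).code - 3) / 7)).2)).1) (Tm.ofCode
          (Nat.unpair ((Nat.unpair (((s x).code - 3) / 7)).2)).2) else
      bif ((s x).code - 3) % 7 == 5 then hcons x (Tm.ofCode (Nat.unpair (((s x).code - 3) / 7)).1)
          (Tm.ofCode (Nat.unpair (((s x).code - 3) / 7)).2) else
      hrecVec x (Tm.ofCode (Nat.unpair (((s x).code - 3) / 7)).1) (Tm.ofCode (Nat.unpair
          ((Nat.unpair (((s x).code - 3) / 7)).2)).1) (Tm.ofCode (Nat.unpair ((Nat.unpair (((s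
          x).code - 3) / 7)).2)).2) := by fun_prop
  refine this.of_eq fun x => ?_
  cases s x <;>
    simp [Tm.code, Tm.elim, Nat.mul_add_div, Nat.add_sub_assoc]

@[fun_prop] theorem Ty.computable_vec {f : α → Ty} {g : α → Tm} (hf : Computable f) (hg :
    Computable g) :
    Computable fun x => Ty.vec (f x) (g x) :=
  Ty.computable_of_code (by simp only [Ty.code]; fun_prop)

@[fun_prop] theorem Ty.computable_pi {f : α → Ty} {g : α → Ty} (hf : Computable f) (hg :
    Computable g) :
    Computable fun x => Ty.pi (f x) (g x) :=
  Ty.computable_of_code (by simp only [Ty.code]; fun_prop)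

@[fun_prop] theorem Ty.computable_all {f : α → Ty} {g : α → Ty} (hf : Computable f) (hg :
    Computable g) :
    Computable fun x => Ty.all (f x) (g x) :=
  Ty.computable_of_code (by simp only [Ty.code]; fun_prop)

@[fun_prop] theorem Ty.computable_eq {f : α → Tm} {g : α → Tm} (hf : Computable f) (hg :
    Computable g) :
    Computable fun x => Ty.eq (f x) (g x) :=
  Ty.computable_of_code (by simp only [Ty.code]; fun_prop)

/-- Case distinction on the constructor, without dependent types. -/
def Ty.elim {σ : Type} (hnat : σ) (hvec : Ty → Tm → σ) (hpi : Ty → Ty → σ) (hall : Ty → Ty → σ)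
    (heq : Tm → Tm → σ) : Ty → σ
  | .nat => hnat
  | .vec x y => hvec x y
  | .pi x y => hpi x y
  | .all x y => hall x y
  | .eq x y => heq x y

@[fun_prop] theorem Ty.computable_elim {s : α → Ty}
    {hnat : α → σ}
    {hvec : α → Ty → Tm → σ}
    {hpi : α → Ty → Ty → σ}
    {hall : α → Ty → Ty → σ}
    {heq : α → Tm → Tm → σ}
    (hs : Computable s)
    (hnat' : Computable hnat)
    (hvec' : Computable fun p : α × Ty × Tm => hvec p.1 p.2.1 p.2.2)
    (hpi' : Computable fun p : α × Ty × Ty => hpi p.1 p.2.1 p.2.2)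
    (hall' : Computable fun p : α × Ty × Ty => hall p.1 p.2.1 p.2.2)
    (heq' : Computable fun p : α × Tm × Tm => heq p.1 p.2.1 p.2.2)
    : Computable fun x => Ty.elim (hnat x) (hvec x) (hpi x) (hall x) (heq x) (s x) := by
  have evec : Computable fun x => hvec x (Ty.ofCode (Nat.unpair (((s x).code - 1) / 4)).1)
      (Tm.ofCode (Nat.unpair (((s x).code - 1) / 4)).2) :=
    Computable.comp_fun (g := fun x => (x, (Ty.ofCode (Nat.unpair (((s x).code - 1) / 4)).1),
        (Tm.ofCode (Nat.unpair (((s x).code - 1) / 4)).2))) hvec' (by fun_prop)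
  have epi : Computable fun x => hpi x (Ty.ofCode (Nat.unpair (((s x).code - 1) / 4)).1)
      (Ty.ofCode (Nat.unpair (((s x).code - 1) / 4)).2) :=
    Computable.comp_fun (g := fun x => (x, (Ty.ofCode (Nat.unpair (((s x).code - 1) / 4)).1),
        (Ty.ofCode (Nat.unpair (((s x).code - 1) / 4)).2))) hpi' (by fun_prop)
  have eall : Computable fun x => hall x (Ty.ofCode (Nat.unpair (((s x).code - 1) / 4)).1)
      (Ty.ofCode (Nat.unpair (((s x).code - 1) / 4)).2) :=
    Computable.comp_fun (g := fun x => (x, (Ty.ofCode (Nat.unpair (((s x).code - 1) / 4)).1),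
        (Ty.ofCode (Nat.unpair (((s x).code - 1) / 4)).2))) hall' (by fun_prop)
  have eeq : Computable fun x => heq x (Tm.ofCode (Nat.unpair (((s x).code - 1) / 4)).1)
      (Tm.ofCode (Nat.unpair (((s x).code - 1) / 4)).2) :=
    Computable.comp_fun (g := fun x => (x, (Tm.ofCode (Nat.unpair (((s x).code - 1) / 4)).1),
        (Tm.ofCode (Nat.unpair (((s x).code - 1) / 4)).2))) heq' (by fun_prop)
  have : Computable fun x =>
      bif (s x).code == 0 then hnat x else
      bif ((s x).code - 1) % 4 == 0 then hvec x (Ty.ofCode (Nat.unpair (((s x).code - 1) / 4)).1)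
          (Tm.ofCode (Nat.unpair (((s x).code - 1) / 4)).2) else
      bif ((s x).code - 1) % 4 == 1 then hpi x (Ty.ofCode (Nat.unpair (((s x).code - 1) / 4)).1)
          (Ty.ofCode (Nat.unpair (((s x).code - 1) / 4)).2) else
      bif ((s x).code - 1) % 4 == 2 then hall x (Ty.ofCode (Nat.unpair (((s x).code - 1) / 4)).1)
          (Ty.ofCode (Nat.unpair (((s x).code - 1) / 4)).2) else
      heq x (Tm.ofCode (Nat.unpair (((s x).code - 1) / 4)).1) (Tm.ofCode (Nat.unpair (((s x).code
          - 1) / 4)).2) := by fun_prop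
  refine this.of_eq fun x => ?_
  cases s x <;>
    simp [Ty.code, Ty.elim, Nat.mul_add_div]

/-- Case distinction on the constructor, without dependent types. -/
def ATm.elim {σ : Type} (hzero : σ) (hvar : ℕ → σ) (happ : ATm → ATm → σ) (hsapp : ATm → ATm → σ)
    (hlam : Ty → ATm → σ) (hslam : Ty → ATm → σ) (hsucc : ATm → σ) (hrecNat : Ty → ATm → ATm → ATm
    → σ) (hnil : Ty → σ) (hcons : ATm → ATm → σ) (hrecVec : Ty → ATm → ATm → ATm → σ) (hjoin : ATm
    → ATm → σ) (hcast : Ty → ATm → ATm → σ) : ATm → σ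
  | .zero => hzero
  | .var x => hvar x
  | .app x y => happ x y
  | .sapp x y => hsapp x y
  | .lam x y => hlam x y
  | .slam x y => hslam x y
  | .succ x => hsucc x
  | .recNat x y z w => hrecNat x y z w
  | .nil x => hnil x
  | .cons x y => hcons x y
  | .recVec x y z w => hrecVec x y z w
  | .join x y => hjoin x y
  | .cast x y z => hcast x y z

@[fun_prop] theorem ATm.computable_elim {s : α → ATm}
    {hzero : α → σ}
    {hvar : α → ℕ → σ}
    {happ : α → ATm → ATm → σ}
    {hsapp : α → ATm → ATm → σ}
    {hlam : α → Ty → ATm → σ}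
    {hslam : α → Ty → ATm → σ}
    {hsucc : α → ATm → σ}
    {hrecNat : α → Ty → ATm → ATm → ATm → σ}
    {hnil : α → Ty → σ}
    {hcons : α → ATm → ATm → σ}
    {hrecVec : α → Ty → ATm → ATm → ATm → σ}
    {hjoin : α → ATm → ATm → σ}
    {hcast : α → Ty → ATm → ATm → σ}
    (hs : Computable s)
    (hzero' : Computable hzero)
    (hvar' : Computable fun p : α × ℕ => hvar p.1 p.2)
    (happ' : Computable fun p : α × ATm × ATm => happ p.1 p.2.1 p.2.2)
    (hsapp' : Computable fun p : α × ATm × ATm => hsapp p.1 p.2.1 p.2.2)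
    (hlam' : Computable fun p : α × Ty × ATm => hlam p.1 p.2.1 p.2.2)
    (hslam' : Computable fun p : α × Ty × ATm => hslam p.1 p.2.1 p.2.2)
    (hsucc' : Computable fun p : α × ATm => hsucc p.1 p.2)
    (hrecNat' : Computable fun p : α × Ty × ATm × ATm × ATm => hrecNat p.1 p.2.1 p.2.2.1 p.2.2.2.1
        p.2.2.2.2)
    (hnil' : Computable fun p : α × Ty => hnil p.1 p.2)
    (hcons' : Computable fun p : α × ATm × ATm => hcons p.1 p.2.1 p.2.2)
    (hrecVec' : Computable fun p : α × Ty × ATm × ATm × ATm => hrecVec p.1 p.2.1 p.2.2.1 p.2.2.2.1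
        p.2.2.2.2)
    (hjoin' : Computable fun p : α × ATm × ATm => hjoin p.1 p.2.1 p.2.2)
    (hcast' : Computable fun p : α × Ty × ATm × ATm => hcast p.1 p.2.1 p.2.2.1 p.2.2.2)
    : Computable fun x => ATm.elim (hzero x) (hvar x) (happ x) (hsapp x) (hlam x) (hslam x) (hsucc
        x) (hrecNat x) (hnil x) (hcons x) (hrecVec x) (hjoin x) (hcast x) (s x) := by
  have evar : Computable fun x => hvar x (((s x).code - 1) / 12) :=
    Computable.comp_fun (g := fun x => (x, (((s x).code - 1) / 12))) hvar' (by fun_prop)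
  have eapp : Computable fun x => happ x (ATm.ofCode (Nat.unpair (((s x).code - 1) / 12)).1)
      (ATm.ofCode (Nat.unpair (((s x).code - 1) / 12)).2) :=
    Computable.comp_fun (g := fun x => (x, (ATm.ofCode (Nat.unpair (((s x).code - 1) / 12)).1),
        (ATm.ofCode (Nat.unpair (((s x).code - 1) / 12)).2))) happ' (by fun_prop)
  have esapp : Computable fun x => hsapp x (ATm.ofCode (Nat.unpair (((s x).code - 1) / 12)).1)
      (ATm.ofCode (Nat.unpair (((s x).code - 1) / 12)).2) :=
    Computable.comp_fun (g := fun x => (x, (ATm.ofCode (Nat.unpair (((s x).code - 1) / 12)).1),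
        (ATm.ofCode (Nat.unpair (((s x).code - 1) / 12)).2))) hsapp' (by fun_prop)
  have elam : Computable fun x => hlam x (Ty.ofCode (Nat.unpair (((s x).code - 1) / 12)).1)
      (ATm.ofCode (Nat.unpair (((s x).code - 1) / 12)).2) :=
    Computable.comp_fun (g := fun x => (x, (Ty.ofCode (Nat.unpair (((s x).code - 1) / 12)).1),
        (ATm.ofCode (Nat.unpair (((s x).code - 1) / 12)).2))) hlam' (by fun_prop)
  have eslam : Computable fun x => hslam x (Ty.ofCode (Nat.unpair (((s x).code - 1) / 12)).1)
      (ATm.ofCode (Nat.unpair (((s x).code - 1) / 12)).2) :=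
    Computable.comp_fun (g := fun x => (x, (Ty.ofCode (Nat.unpair (((s x).code - 1) / 12)).1),
        (ATm.ofCode (Nat.unpair (((s x).code - 1) / 12)).2))) hslam' (by fun_prop)
  have esucc : Computable fun x => hsucc x (ATm.ofCode (((s x).code - 1) / 12)) :=
    Computable.comp_fun (g := fun x => (x, (ATm.ofCode (((s x).code - 1) / 12)))) hsucc' (by
        fun_prop)
  have erecNat : Computable fun x => hrecNat x (Ty.ofCode (Nat.unpair (((s x).code - 1) / 12)).1)
      (ATm.ofCode (Nat.unpair ((Nat.unpair (((s x).code - 1) / 12)).2)).1) (ATm.ofCode (Nat.unpair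
      ((Nat.unpair ((Nat.unpair (((s x).code - 1) / 12)).2)).2)).1) (ATm.ofCode (Nat.unpair
      ((Nat.unpair ((Nat.unpair (((s x).code - 1) / 12)).2)).2)).2) :=
    Computable.comp_fun (g := fun x => (x, (Ty.ofCode (Nat.unpair (((s x).code - 1) / 12)).1),
        (ATm.ofCode (Nat.unpair ((Nat.unpair (((s x).code - 1) / 12)).2)).1), (ATm.ofCode
        (Nat.unpair ((Nat.unpair ((Nat.unpair (((s x).code - 1) / 12)).2)).2)).1), (ATm.ofCode
        (Nat.unpair ((Nat.unpair ((Nat.unpair (((s x).code - 1) / 12)).2)).2)).2))) hrecNat' (by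
        fun_prop)
  have enil : Computable fun x => hnil x (Ty.ofCode (((s x).code - 1) / 12)) :=
    Computable.comp_fun (g := fun x => (x, (Ty.ofCode (((s x).code - 1) / 12)))) hnil' (by fun_prop)
  have econs : Computable fun x => hcons x (ATm.ofCode (Nat.unpair (((s x).code - 1) / 12)).1)
      (ATm.ofCode (Nat.unpair (((s x).code - 1) / 12)).2) :=
    Computable.comp_fun (g := fun x => (x, (ATm.ofCode (Nat.unpair (((s x).code - 1) / 12)).1),
        (ATm.ofCode (Nat.unpair (((s x).code - 1) / 12)).2))) hcons' (by fun_prop)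
  have erecVec : Computable fun x => hrecVec x (Ty.ofCode (Nat.unpair (((s x).code - 1) / 12)).1)
      (ATm.ofCode (Nat.unpair ((Nat.unpair (((s x).code - 1) / 12)).2)).1) (ATm.ofCode (Nat.unpair
      ((Nat.unpair ((Nat.unpair (((s x).code - 1) / 12)).2)).2)).1) (ATm.ofCode (Nat.unpair
      ((Nat.unpair ((Nat.unpair (((s x).code - 1) / 12)).2)).2)).2) :=
    Computable.comp_fun (g := fun x => (x, (Ty.ofCode (Nat.unpair (((s x).code - 1) / 12)).1),
        (ATm.ofCode (Nat.unpair ((Nat.unpair (((s x).code - 1) / 12)).2)).1), (ATm.ofCode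
        (Nat.unpair ((Nat.unpair ((Nat.unpair (((s x).code - 1) / 12)).2)).2)).1), (ATm.ofCode
        (Nat.unpair ((Nat.unpair ((Nat.unpair (((s x).code - 1) / 12)).2)).2)).2))) hrecVec' (by
        fun_prop)
  have ejoin : Computable fun x => hjoin x (ATm.ofCode (Nat.unpair (((s x).code - 1) / 12)).1)
      (ATm.ofCode (Nat.unpair (((s x).code - 1) / 12)).2) :=
    Computable.comp_fun (g := fun x => (x, (ATm.ofCode (Nat.unpair (((s x).code - 1) / 12)).1),
        (ATm.ofCode (Nat.unpair (((s x).code - 1) / 12)).2))) hjoin' (by fun_prop)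
  have ecast : Computable fun x => hcast x (Ty.ofCode (Nat.unpair (((s x).code - 1) / 12)).1)
      (ATm.ofCode (Nat.unpair ((Nat.unpair (((s x).code - 1) / 12)).2)).1) (ATm.ofCode (Nat.unpair
      ((Nat.unpair (((s x).code - 1) / 12)).2)).2) :=
    Computable.comp_fun (g := fun x => (x, (Ty.ofCode (Nat.unpair (((s x).code - 1) / 12)).1),
        (ATm.ofCode (Nat.unpair ((Nat.unpair (((s x).code - 1) / 12)).2)).1), (ATm.ofCode
        (Nat.unpair ((Nat.unpair (((s x).code - 1) / 12)).2)).2))) hcast' (by fun_prop)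
  have : Computable fun x =>
      bif (s x).code == 0 then hzero x else
      bif ((s x).code - 1) % 12 == 0 then hvar x (((s x).code - 1) / 12) else
      bif ((s x).code - 1) % 12 == 1 then happ x (ATm.ofCode (Nat.unpair (((s x).code - 1) /
          12)).1) (ATm.ofCode (Nat.unpair (((s x).code - 1) / 12)).2) else
      bif ((s x).code - 1) % 12 == 2 then hsapp x (ATm.ofCode (Nat.unpair (((s x).code - 1) /
          12)).1) (ATm.ofCode (Nat.unpair (((s x).code - 1) / 12)).2) else
      bif ((s x).code - 1) % 12 == 3 then hlam x (Ty.ofCode (Nat.unpair (((s x).code - 1) /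
          12)).1) (ATm.ofCode (Nat.unpair (((s x).code - 1) / 12)).2) else
      bif ((s x).code - 1) % 12 == 4 then hslam x (Ty.ofCode (Nat.unpair (((s x).code - 1) /
          12)).1) (ATm.ofCode (Nat.unpair (((s x).code - 1) / 12)).2) else
      bif ((s x).code - 1) % 12 == 5 then hsucc x (ATm.ofCode (((s x).code - 1) / 12)) else
      bif ((s x).code - 1) % 12 == 6 then hrecNat x (Ty.ofCode (Nat.unpair (((s x).code - 1) /
          12)).1) (ATm.ofCode (Nat.unpair ((Nat.unpair (((s x).code - 1) / 12)).2)).1) (ATm.ofCode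
          (Nat.unpair ((Nat.unpair ((Nat.unpair (((s x).code - 1) / 12)).2)).2)).1) (ATm.ofCode
          (Nat.unpair ((Nat.unpair ((Nat.unpair (((s x).code - 1) / 12)).2)).2)).2) else
      bif ((s x).code - 1) % 12 == 7 then hnil x (Ty.ofCode (((s x).code - 1) / 12)) else
      bif ((s x).code - 1) % 12 == 8 then hcons x (ATm.ofCode (Nat.unpair (((s x).code - 1) /
          12)).1) (ATm.ofCode (Nat.unpair (((s x).code - 1) / 12)).2) else
      bif ((s x).code - 1) % 12 == 9 then hrecVec x (Ty.ofCode (Nat.unpair (((s x).code - 1) /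
          12)).1) (ATm.ofCode (Nat.unpair ((Nat.unpair (((s x).code - 1) / 12)).2)).1) (ATm.ofCode
          (Nat.unpair ((Nat.unpair ((Nat.unpair (((s x).code - 1) / 12)).2)).2)).1) (ATm.ofCode
          (Nat.unpair ((Nat.unpair ((Nat.unpair (((s x).code - 1) / 12)).2)).2)).2) else
      bif ((s x).code - 1) % 12 == 10 then hjoin x (ATm.ofCode (Nat.unpair (((s x).code - 1) /
          12)).1) (ATm.ofCode (Nat.unpair (((s x).code - 1) / 12)).2) else
      hcast x (Ty.ofCode (Nat.unpair (((s x).code - 1) / 12)).1) (ATm.ofCode (Nat.unpair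
          ((Nat.unpair (((s x).code - 1) / 12)).2)).1) (ATm.ofCode (Nat.unpair ((Nat.unpair (((s
          x).code - 1) / 12)).2)).2) := by fun_prop
  refine this.of_eq fun x => ?_
  cases s x <;>
    simp [ATm.code, ATm.elim, Nat.mul_add_div]

end Computability

/-! ### The substitution calculus -/

theorem liftRen_comp (f g : ℕ → ℕ) : liftRen (f ∘ g) = liftRen f ∘ liftRen g := by
  funext n; cases n <;> rfl

theorem Tm.rename_rename (a : Tm) (f g : ℕ → ℕ) :
    (a.rename g).rename f = a.rename (f ∘ g) := by
  induction a generalizing f g <;> simp_all [Tm.rename, liftRen_comp]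

theorem liftSub_comp_liftRen (s : ℕ → Tm) (f : ℕ → ℕ) :
    liftSub (s ∘ f) = liftSub s ∘ liftRen f := by
  funext n; cases n <;> rfl

theorem Tm.rename_subst (a : Tm) (s : ℕ → Tm) (f : ℕ → ℕ) :
    (a.rename f).subst s = a.subst (s ∘ f) := by
  induction a generalizing f s <;> simp_all [Tm.rename, Tm.subst, liftSub_comp_liftRen]

theorem liftSub_rename (s : ℕ → Tm) (f : ℕ → ℕ) :
    liftSub (fun n => (s n).rename f) = fun n => (liftSub s n).rename (liftRen f) := by
  funext n
  cases n with
  | zero => rfl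
  | succ n => simp only [liftSub, scons, Tm.rename_rename]; rfl

theorem Tm.subst_rename (a : Tm) (s : ℕ → Tm) (f : ℕ → ℕ) :
    (a.subst s).rename f = a.subst fun n => (s n).rename f := by
  induction a generalizing f s <;> simp_all [Tm.rename, Tm.subst, liftSub_rename]

theorem liftSub_subst (s u : ℕ → Tm) :
    liftSub (fun n => (s n).subst u) = fun n => (liftSub s n).subst (liftSub u) := by
  funext n
  cases n with
  | zero => rfl
  | succ n =>
    simp only [liftSub, scons, Tm.rename_subst, Tm.subst_rename]
    rfl

theorem Tm.subst_subst (a : Tm) (s u : ℕ → Tm) :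
    (a.subst s).subst u = a.subst fun n => (s n).subst u := by
  induction a generalizing s u <;> simp_all [Tm.subst, liftSub_subst]

theorem liftSub_var : liftSub Tm.var = Tm.var := by
  funext n; cases n <;> rfl

theorem Tm.subst_var (a : Tm) : a.subst Tm.var = a := by
  induction a <;> simp_all [Tm.subst, liftSub_var]

theorem Tm.rename_eq_subst (a : Tm) (f : ℕ → ℕ) : a.rename f = a.subst fun n => .var (f n) := by
  have := (Tm.rename_subst a Tm.var f).symm
  rwa [Tm.subst_var, eq_comm] at this

theorem Tm.inst_subst (a b : Tm) (s : ℕ → Tm) :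
    (a.inst b).subst s = (a.subst (liftSub s)).inst (b.subst s) := by
  simp only [Tm.inst, Tm.subst_subst]
  congr 1
  funext n
  cases n with
  | zero => rfl
  | succ n =>
    simp only [liftSub, scons, Tm.rename_subst]
    exact (Tm.subst_var _).symm

/-- Contracting a β-redex whose function is a substituted abstraction amounts to extending the
substitution; the abstraction case of the fundamental lemma needs this form. -/
theorem Tm.subst_liftSub_inst (a b : Tm) (s : ℕ → Tm) :
    (a.subst (liftSub s)).inst b = a.subst (scons b s) := by
  simp only [Tm.inst, Tm.subst_subst]
  congr 1
  funext n
  cases n with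
  | zero => rfl
  | succ n =>
    simp only [liftSub, scons, Tm.rename_subst]
    exact Tm.subst_var _

theorem liftSub_rename_var (f : ℕ → ℕ) :
    liftSub (fun n => .var (f n)) = fun n => .var (liftRen f n) := by
  funext n; cases n <;> rfl

theorem Ty.rename_eq_subst (φ : Ty) (f : ℕ → ℕ) : φ.rename f = φ.subst fun n => .var (f n) := by
  induction φ generalizing f <;>
    simp_all [Ty.rename, Ty.subst, liftSub_rename_var, Tm.rename_eq_subst]

/-! ### Free variables as obstructions to substitution -/

theorem liftSub_succ_eq_var_iff (s : ℕ → Tm) (n : ℕ) :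
    liftSub s (n + 1) = .var (n + 1) ↔ s n = .var n := by
  simp only [liftSub, scons]
  cases s n <;> simp [Tm.rename]

theorem forall_liftSub_iff (P : ℕ → Prop) (s : ℕ → Tm) :
    (∀ n, P n → liftSub s n = .var n) ↔ ∀ n, P (n + 1) → s n = .var n := by
  constructor
  · exact fun h n hn => (liftSub_succ_eq_var_iff s n).1 (h _ hn)
  · rintro h (_ | n) hn
    · rfl
    · exact (liftSub_succ_eq_var_iff s n).2 (h n hn)

/-- This turns statements about free variables into equations, which can be decided by performing a
substitution and comparing codes. -/
theorem Tm.subst_eq_self_iff (a : Tm) (s : ℕ → Tm) :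
    a.subst s = a ↔ ∀ n, a.Occurs n → s n = .var n := by
  induction a generalizing s <;>
    simp_all [Tm.subst, Tm.Occurs, forall_liftSub_iff, or_imp, forall_and]

theorem Ty.subst_eq_self_iff (φ : Ty) (s : ℕ → Tm) :
    φ.subst s = φ ↔ ∀ n, φ.Occurs n → s n = .var n := by
  induction φ generalizing s <;>
    simp_all [Ty.subst, Ty.Occurs, forall_liftSub_iff, or_imp, forall_and, Tm.subst_eq_self_iff]

/-! ### Substitutions given by finite data -/

/-- The substitution that sends the first indices to the terms of a list, and shifts the
others. -/
def listSub (l : List Tm) (d : ℕ) : ℕ → Tm := l.foldr scons (shiftVar d)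

theorem listSub_apply (l : List Tm) (d n : ℕ) :
    listSub l d n = (l[n]?).getD (.var (n - l.length + d)) := by
  induction l generalizing n with
  | nil => simp [listSub, shiftVar]
  | cons a l ih =>
    cases n with
    | zero => rfl
    | succ n => simpa [listSub, scons] using ih n

theorem iterate_liftRen_apply (f : ℕ → ℕ) (k n : ℕ) :
    liftRen^[k] f n = if n < k then n else f (n - k) + k := by
  induction k generalizing n with
  | zero => simp
  | succ k ih =>
    rw [Function.iterate_succ_apply']
    cases n with
    | zero => simp [liftRen]
    | succ n =>
      simp only [liftRen, ih, Nat.succ_lt_succ_iff, Nat.add_sub_add_right]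
      split <;> rfl

theorem iterate_liftSub_apply (s : ℕ → Tm) (k n : ℕ) :
    liftSub^[k] s n = if n < k then .var n else (s (n - k)).rename (· + k) := by
  induction k generalizing n with
  | zero => simpa using ((s n).rename_eq_subst _).symm ▸ (Tm.subst_var (s n)).symm
  | succ k ih =>
    rw [Function.iterate_succ_apply']
    cases n with
    | zero => simp [liftSub, scons]
    | succ n =>
      simp only [liftSub, scons, ih, Nat.succ_lt_succ_iff, Nat.add_sub_add_right]
      split
      · rfl
      · rw [Tm.rename_rename]; rfl

/-- The substitution moves the index `0` to `1` and fixes every other index. -/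
theorem Tm.not_occurs_zero_iff (a : Tm) : ¬ a.Occurs 0 ↔ a.subst (listSub [.var 1] 1) = a := by
  rw [Tm.subst_eq_self_iff]
  constructor
  · rintro h (_ | n) hn
    · exact absurd hn h
    · simp [listSub_apply]
  · intro h h0
    simpa [listSub_apply] using h 0 h0

/-- The lifted shift fixes the indices below `k` and moves all the others. -/
theorem Ty.occurs_lt_iff (φ : Ty) (k : ℕ) :
    (∀ n, φ.Occurs n → n < k) ↔ φ.subst (liftSub^[k] (listSub [] 1)) = φ := by
  rw [Ty.subst_eq_self_iff]
  refine forall₂_congr fun n _ => ?_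
  rw [iterate_liftSub_apply]
  split
  · simpa
  · simp [listSub_apply, Tm.rename]; omega

/-- The index `0` stays put because `Nat.pred 0 = 0`. The right-hand side is given by finite data,
hence covered by the computability of substitution. -/
theorem Tm.rename_pred (a : Tm) : a.rename Nat.pred = a.subst (listSub [.var 0] 0) := by
  rw [Tm.rename_eq_subst]
  congr 1
  funext n
  cases n <;> simp [listSub_apply]

theorem Ty.weaken_eq_subst (φ : Ty) (k : ℕ) : φ.weaken k = φ.subst (listSub [] k) :=
  φ.rename_eq_subst _

/-! ### Computability of substitution -/

section Computability

variable {α : Type} [Primcodable α]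

/-- A renaming is a function and has no code, so the recursion carries two numbers instead: how many
binders have been crossed and how far to shift. -/
theorem Tm.computable_rename_shift : Computable fun p : (ℕ × ℕ) × Tm =>
    p.2.rename (liftRen^[p.1.1] (· + p.1.2)) := by
  refine Computable.wf_rec (InvImage.wf (fun p : (ℕ × ℕ) × Tm => sizeOf p.2) Nat.lt_wfRel.wf)
    (next := fun p => p.2.elim [] [] [] (fun _ => []) (fun a b => [(p.1, a), (p.1, b)])
      (fun a => [((p.1.1 + 1, p.1.2), a)]) (fun a => [(p.1, a)])
      (fun a b c => [(p.1, a), (p.1, b), (p.1, c)]) (fun a b => [(p.1, a), (p.1, b)])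
      (fun a b c => [(p.1, a), (p.1, b), (p.1, c)]))
    -- The test `k - n == 0` with truncated subtraction means `k ≤ n`. The defaults `.nil` are never
    -- used, as the list holds one result per recursive call.
    (step := fun q => q.1.2.elim .zero .nil .join
      (fun n => bif q.1.1.1 - n == 0 then .var (n + q.1.1.2) else .var n)
      (fun _ _ => .app (q.2[0]?.getD .nil) (q.2[1]?.getD .nil))
      (fun _ => .lam (q.2[0]?.getD .nil))
      (fun _ => .succ (q.2[0]?.getD .nil))
      (fun _ _ _ => .recNat (q.2[0]?.getD .nil) (q.2[1]?.getD .nil) (q.2[2]?.getD .nil))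
      (fun _ _ => .cons (q.2[0]?.getD .nil) (q.2[1]?.getD .nil))
      (fun _ _ _ => .recVec (q.2[0]?.getD .nil) (q.2[1]?.getD .nil) (q.2[2]?.getD .nil)))
    (by fun_prop) (by fun_prop) ?_ ?_
  · rintro ⟨p, a⟩
    cases a <;> simp [Tm.elim, InvImage, WellFoundedRelation.rel] <;> omega
  · rintro ⟨p, a⟩
    cases a <;> simp [Tm.elim, Tm.rename, ← Function.iterate_succ_apply' liftRen]
    rename_i n
    rw [iterate_liftRen_apply]
    rcases lt_or_ge n p.1 with h | h
    · have h' : (p.1 - n == 0) = false := by simp [Nat.sub_eq_zero_iff_le, h]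
      simp [h, h']
    · simp [h.not_gt, Nat.sub_eq_zero_of_le h]
      omega

@[fun_prop] theorem Tm.computable_rename_add {f : α → Tm} {g : α → ℕ} (hf : Computable f)
    (hg : Computable g) : Computable fun x => (f x).rename (· + g x) :=
  Tm.computable_rename_shift.comp (((Computable.const 0).pair hg).pair hf)

/-- As for renaming, the substitution is represented by data: binders crossed, listed values, and
the shift for the remaining indices. A value taken from the list is weakened by the number of
binders crossed. -/
theorem Tm.computable_subst_aux : Computable fun p : (ℕ × List Tm × ℕ) × Tm =>
    p.2.subst (liftSub^[p.1.1] (listSub p.1.2.1 p.1.2.2)) := by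
  refine Computable.wf_rec
    (InvImage.wf (fun p : (ℕ × List Tm × ℕ) × Tm => sizeOf p.2) Nat.lt_wfRel.wf)
    (next := fun p => p.2.elim [] [] [] (fun _ => []) (fun a b => [(p.1, a), (p.1, b)])
      (fun a => [((p.1.1 + 1, p.1.2), a)]) (fun a => [(p.1, a)])
      (fun a b c => [(p.1, a), (p.1, b), (p.1, c)]) (fun a b => [(p.1, a), (p.1, b)])
      (fun a b c => [(p.1, a), (p.1, b), (p.1, c)]))
    (step := fun q => q.1.2.elim .zero .nil .join
      (fun n => bif q.1.1.1 - n == 0 then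
          (q.1.1.2.1[n - q.1.1.1]?.getD
            (.var (n - q.1.1.1 - q.1.1.2.1.length + q.1.1.2.2))).rename (· + q.1.1.1)
        else .var n)
      (fun _ _ => .app (q.2[0]?.getD .nil) (q.2[1]?.getD .nil))
      (fun _ => .lam (q.2[0]?.getD .nil))
      (fun _ => .succ (q.2[0]?.getD .nil))
      (fun _ _ _ => .recNat (q.2[0]?.getD .nil) (q.2[1]?.getD .nil) (q.2[2]?.getD .nil))
      (fun _ _ => .cons (q.2[0]?.getD .nil) (q.2[1]?.getD .nil))
      (fun _ _ _ => .recVec (q.2[0]?.getD .nil) (q.2[1]?.getD .nil) (q.2[2]?.getD .nil)))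
    (by fun_prop) (by fun_prop) ?_ ?_
  · rintro ⟨p, a⟩
    cases a <;> simp [Tm.elim, InvImage, WellFoundedRelation.rel] <;> omega
  · rintro ⟨p, a⟩
    cases a <;> simp [Tm.elim, Tm.subst, ← Function.iterate_succ_apply' liftSub]
    rename_i n
    rw [iterate_liftSub_apply]
    rcases lt_or_ge n p.1 with h | h
    · have h' : (p.1 - n == 0) = false := by simp [Nat.sub_eq_zero_iff_le, h]
      simp [h, h']
    · simp [h.not_gt, Nat.sub_eq_zero_of_le h, listSub_apply]

@[fun_prop] theorem Tm.computable_subst {f : α → Tm} {k : α → ℕ} {l : α → List Tm} {d : α → ℕ}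
    (hf : Computable f) (hk : Computable k) (hl : Computable l) (hd : Computable d) :
    Computable fun x => (f x).subst (liftSub^[k x] (listSub (l x) (d x))) :=
  Tm.computable_subst_aux.comp ((hk.pair (hl.pair hd)).pair hf)

theorem Ty.computable_subst_aux : Computable fun p : (ℕ × List Tm × ℕ) × Ty =>
    p.2.subst (liftSub^[p.1.1] (listSub p.1.2.1 p.1.2.2)) := by
  refine Computable.wf_rec
    (InvImage.wf (fun p : (ℕ × List Tm × ℕ) × Ty => sizeOf p.2) Nat.lt_wfRel.wf)
    (next := fun p => p.2.elim [] (fun φ _ => [(p.1, φ)])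
      (fun φ ψ => [(p.1, φ), ((p.1.1 + 1, p.1.2), ψ)])
      (fun φ ψ => [(p.1, φ), ((p.1.1 + 1, p.1.2), ψ)]) (fun _ _ => []))
    (step := fun q => q.1.2.elim .nat
      (fun _ a => .vec (q.2[0]?.getD .nat)
        (a.subst (liftSub^[q.1.1.1] (listSub q.1.1.2.1 q.1.1.2.2))))
      (fun _ _ => .pi (q.2[0]?.getD .nat) (q.2[1]?.getD .nat))
      (fun _ _ => .all (q.2[0]?.getD .nat) (q.2[1]?.getD .nat))
      (fun a b => .eq (a.subst (liftSub^[q.1.1.1] (listSub q.1.1.2.1 q.1.1.2.2)))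
        (b.subst (liftSub^[q.1.1.1] (listSub q.1.1.2.1 q.1.1.2.2)))))
    (by fun_prop) (by fun_prop) ?_ ?_
  · rintro ⟨p, a⟩
    cases a <;> simp [Ty.elim, InvImage, WellFoundedRelation.rel] <;> omega
  · rintro ⟨p, a⟩
    cases a <;> simp [Ty.elim, Ty.subst, ← Function.iterate_succ_apply' liftSub]

@[fun_prop] theorem Ty.computable_subst {f : α → Ty} {k : α → ℕ} {l : α → List Tm} {d : α → ℕ}
    (hf : Computable f) (hk : Computable k) (hl : Computable l) (hd : Computable d) :
    Computable fun x => (f x).subst (liftSub^[k x] (listSub (l x) (d x))) :=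
  Ty.computable_subst_aux.comp ((hk.pair (hl.pair hd)).pair hf)

@[fun_prop] theorem Tm.computable_subst_listSub {f : α → Tm} {l : α → List Tm} {d : α → ℕ}
    (hf : Computable f) (hl : Computable l) (hd : Computable d) :
    Computable fun x => (f x).subst (listSub (l x) (d x)) :=
  Tm.computable_subst hf (Computable.const 0) hl hd

@[fun_prop] theorem Ty.computable_subst_listSub {f : α → Ty} {l : α → List Tm} {d : α → ℕ}
    (hf : Computable f) (hl : Computable l) (hd : Computable d) :
    Computable fun x => (f x).subst (listSub (l x) (d x)) :=
  Ty.computable_subst hf (Computable.const 0) hl hd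

@[fun_prop] theorem Tm.computable_inst {f g : α → Tm} (hf : Computable f) (hg : Computable g) :
    Computable fun x => (f x).inst (g x) :=
  Tm.computable_subst_listSub (l := fun x => [g x]) (d := fun _ => 0) hf (by fun_prop) (by fun_prop)

@[fun_prop] theorem Ty.computable_inst {f : α → Ty} {g : α → Tm} (hf : Computable f)
    (hg : Computable g) : Computable fun x => (f x).inst (g x) :=
  Ty.computable_subst_listSub (l := fun x => [g x]) (d := fun _ => 0) hf (by fun_prop) (by fun_prop)

@[fun_prop] theorem Ty.computable_inst₂ {f : α → Ty} {g h : α → Tm} (hf : Computable f)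
    (hg : Computable g) (hh : Computable h) : Computable fun x => (f x).inst₂ (g x) (h x) :=
  Ty.computable_subst_listSub (l := fun x => [h x, g x]) (d := fun _ => 0) hf (by fun_prop)
    (by fun_prop)

@[fun_prop] theorem Ty.computable_weaken {f : α → Ty} {k : α → ℕ} (hf : Computable f)
    (hk : Computable k) : Computable fun x => (f x).weaken (k x) := by
  simp only [Ty.weaken_eq_subst]
  fun_prop

@[fun_prop] theorem computable_natStepTy {f : α → Ty} (hf : Computable f) :
    Computable fun x => natStepTy (f x) := by
  have h1 := Ty.computable_subst_listSub (l := fun _ => [.var 0]) (d := fun _ => 1) hf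
    (by fun_prop) (by fun_prop)
  have h2 := Ty.computable_subst_listSub (l := fun _ => [.succ (.var 1)]) (d := fun _ => 2) hf
    (by fun_prop) (by fun_prop)
  exact Ty.computable_pi (Computable.const _) (Ty.computable_pi h1 h2)

@[fun_prop] theorem computable_vecStepTy {f g : α → Ty} (hf : Computable f) (hg : Computable g) :
    Computable fun x => vecStepTy (f x) (g x) := by
  have h1 := Ty.computable_subst_listSub (l := fun _ => [.var 0, .var 2]) (d := fun _ => 3) hg
    (by fun_prop) (by fun_prop)
  have h2 := Ty.computable_subst_listSub
    (l := fun _ => [.cons (.var 2) (.var 1), .succ (.var 3)]) (d := fun _ => 4) hg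
    (by fun_prop) (by fun_prop)
  exact Ty.computable_all (Computable.const _) (Ty.computable_pi (by fun_prop)
    (Ty.computable_pi (by fun_prop) (Ty.computable_pi h1 h2)))

end Computability

/-! ### Reducibility -/

/-- Strong normalization. -/
def SN (a : Tm) : Prop := Acc (fun b a => Step a b) a

theorem SN.step {a b : Tm} (h : SN a) (hs : Step a b) : SN b := h.inv hs

/-- An infinite reduction from `a` would be carried by `f` to one from `f a`. -/
theorem SN.of_map {f : Tm → Tm} (hf : ∀ a b, Step a b → Step (f a) (f b)) {a : Tm}
    (h : SN (f a)) : SN a := by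
  generalize hc : f a = c at h
  induction h generalizing a with
  | intro c _ ih =>
    subst hc
    exact ⟨_, fun b hb => ih _ (hf _ _ hb) rfl⟩

theorem Step.subst {a b : Tm} (h : Step a b) (s : ℕ → Tm) : Step (a.subst s) (b.subst s) := by
  induction h generalizing s with
  | beta a b => rw [Tm.inst_subst]; exact .beta _ _
  | recNat_zero => exact .recNat_zero _ _
  | recNat_succ => exact .recNat_succ _ _ _
  | recVec_nil => exact .recVec_nil _ _
  | recVec_cons => exact .recVec_cons _ _ _ _
  | app_left _ _ ih => exact .app_left _ (ih s)
  | app_right _ _ ih => exact .app_right _ (ih s)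
  | lam _ ih => exact .lam (ih _)
  | succ _ ih => exact .succ (ih s)
  | recNat_fst _ _ _ ih => exact .recNat_fst _ _ (ih s)
  | recNat_snd _ _ _ ih => exact .recNat_snd _ _ (ih s)
  | recNat_thd _ _ _ ih => exact .recNat_thd _ _ (ih s)
  | cons_left _ _ ih => exact .cons_left _ (ih s)
  | cons_right _ _ ih => exact .cons_right _ (ih s)
  | recVec_fst _ _ _ ih => exact .recVec_fst _ _ (ih s)
  | recVec_snd _ _ _ ih => exact .recVec_snd _ _ (ih s)
  | recVec_thd _ _ _ ih => exact .recVec_thd _ _ (ih s)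

/-- Terms that are not introduction forms of a type with an elimination form. -/
def Tm.Neutral : Tm → Prop
  | .lam _ | .zero | .succ _ | .nil | .cons _ _ => False
  | _ => True

/-- Reducibility candidates. -/
structure IsCandidate (P : Tm → Prop) : Prop where
  sn : ∀ {a}, P a → SN a
  step : ∀ {a b}, P a → Step a b → P b
  neutral : ∀ {a}, a.Neutral → (∀ b, Step a b → P b) → P a

theorem IsCandidate.var {P : Tm → Prop} (hP : IsCandidate P) (n : ℕ) : P (.var n) :=
  hP.neutral trivial fun _ h => nomatch h

theorem IsCandidate.sn_cand : IsCandidate SN where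
  sn := id
  step := SN.step
  neutral _ h := ⟨_, fun b hb => h b hb⟩

/-- Reducible terms of type `nat`. -/
inductive NatRed : Tm → Prop
  | intro (a : Tm) : (∀ b, Step a b → NatRed b) → (∀ b, a = .succ b → NatRed b) → NatRed a

/-- Reducible vectors with elements in `P`. -/
inductive ListRed (P : Tm → Prop) : Tm → Prop
  | intro (a : Tm) : (∀ b, Step a b → ListRed P b) → (∀ b c, a = .cons b c → P b) →
      (∀ b c, a = .cons b c → ListRed P c) → ListRed P a

theorem NatRed.isCandidate : IsCandidate NatRed where
  sn h := by
    induction h with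
    | intro a _ _ ih _ => exact ⟨_, ih⟩
  step h hs := by
    cases h with
    | intro _ h _ => exact h _ hs
  neutral hn h := ⟨_, h, by rintro b rfl; exact hn.elim⟩

theorem ListRed.isCandidate (P : Tm → Prop) : IsCandidate (ListRed P) where
  sn h := by
    induction h with
    | intro a _ _ _ ih _ => exact ⟨_, ih⟩
  step h hs := by
    cases h with
    | intro _ h _ => exact h _ hs
  neutral hn h := ⟨_, h, by rintro b c rfl; exact hn.elim, by rintro b c rfl; exact hn.elim⟩

theorem NatRed.zero : NatRed .zero := ⟨_, nofun, nofun⟩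

theorem NatRed.succ {a : Tm} (h : NatRed a) : NatRed (.succ a) := by
  induction h with
  | intro a h h' ih _ =>
    refine ⟨_, ?_, ?_⟩
    · rintro _ (_ | _ | _ | _ | _ | _ | _ | _ | hs)
      exact ih _ hs
    · rintro b ⟨⟩
      exact ⟨_, h, h'⟩

theorem ListRed.nil (P : Tm → Prop) : ListRed P .nil := ⟨_, nofun, nofun, nofun⟩

/-- A step of a `cons` happens in the head or in the tail, so induct on termination of the head and,
inside, on reducibility of the tail. -/
theorem ListRed.cons {P : Tm → Prop} (hP : IsCandidate P) {a b : Tm} (ha : P a)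
    (hb : ListRed P b) : ListRed P (.cons a b) := by
  induction hP.sn ha generalizing b with
  | intro a _ iha =>
    induction hb with
    | intro b h h₁ h₂ ihb _ =>
      refine ⟨_, fun c hc => ?_, ?_, ?_⟩
      · cases hc with
        | cons_left _ hs => exact iha _ hs (hP.step ha hs) ⟨_, h, h₁, h₂⟩
        | cons_right _ hs => exact ihb _ hs
      · rintro b c ⟨⟩
        exact ha
      · rintro b c ⟨⟩
        exact ⟨_, h, h₁, h₂⟩

/-- The recursor term is neutral, so it suffices to treat its reducts. Steps inside the arguments
are handled by nested inductions on `a`, `b` and `c`. Unfolding at a successor uses the second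
induction hypothesis of `NatRed`, the one for the predecessor. -/
theorem IsCandidate.recNat {Q : Tm → Prop} (hQ : IsCandidate Q) {a b c : Tm} (ha : Q a)
    (hb : SN b) (hbQ : ∀ n r, NatRed n → Q r → Q (.app (.app b n) r)) (hc : NatRed c) :
    Q (.recNat a b c) := by
  induction hQ.sn ha generalizing b c with
  | intro a _ iha =>
    induction hb generalizing c with
    | intro b hb ihb =>
      induction hc with
      | intro c hc hc' ihc ihc' =>
        refine hQ.neutral trivial fun d hd => ?_
        cases hd with
        | recNat_zero => exact ha
        | recNat_succ _ _ c => exact hbQ _ _ (hc' _ rfl) (ihc' _ rfl)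
        | recNat_fst _ _ hs => exact iha _ hs (hQ.step ha hs) ⟨_, hb⟩ hbQ ⟨_, hc, hc'⟩
        | recNat_snd _ _ hs =>
          exact ihb _ hs (fun n r hn hr => hQ.step (hbQ n r hn hr) (.app_left _ (.app_left _ hs)))
            ⟨_, hc, hc'⟩
        | recNat_thd _ _ hs => exact ihc _ hs

theorem IsCandidate.recVec {P Q : Tm → Prop} (hQ : IsCandidate Q) {a b c : Tm} (ha : Q a)
    (hb : SN b)
    (hbQ : ∀ z v r, P z → ListRed P v → Q r → Q (.app (.app (.app b z) v) r))
    (hc : ListRed P c) : Q (.recVec a b c) := by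
  induction hQ.sn ha generalizing b c with
  | intro a _ iha =>
    induction hb generalizing c with
    | intro b hb ihb =>
      induction hc with
      | intro c hc h₁ h₂ ihc ihc' =>
        refine hQ.neutral trivial fun d hd => ?_
        cases hd with
        | recVec_nil => exact ha
        | recVec_cons _ _ c => exact hbQ _ _ _ (h₁ _ _ rfl) (h₂ _ _ rfl) (ihc' _ _ rfl)
        | recVec_fst _ _ hs => exact iha _ hs (hQ.step ha hs) ⟨_, hb⟩ hbQ ⟨_, hc, h₁, h₂⟩
        | recVec_snd _ _ hs =>
          exact ihb _ hs (fun z v r hz hv hr => hQ.step (hbQ z v r hz hv hr)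
            (.app_left _ (.app_left _ (.app_left _ hs)))) ⟨_, hc, h₁, h₂⟩
        | recVec_thd _ _ hs => exact ihc _ hs

/-- Reducible terms of a type.  The terms in the type are irrelevant. -/
def Ty.Red : Ty → Tm → Prop
  | .nat => NatRed
  | .vec φ _ => ListRed φ.Red
  | .pi φ ψ => fun a => ∀ b, φ.Red b → ψ.Red (.app a b)
  | .all _ ψ => ψ.Red
  | .eq _ _ => SN

/-- For products, termination is tested by applying to a variable, which belongs to every candidate.
-/
theorem Ty.red_isCandidate : ∀ φ : Ty, IsCandidate φ.Red
  | .nat => NatRed.isCandidate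
  | .vec φ _ => ListRed.isCandidate _
  | .all _ ψ => ψ.red_isCandidate
  | .eq _ _ => IsCandidate.sn_cand
  | .pi φ ψ =>
    { sn := fun h => SN.of_map (f := fun a => .app a (.var 0)) (fun _ _ hs => .app_left _ hs)
        (ψ.red_isCandidate.sn (h _ (φ.red_isCandidate.var 0)))
      step := fun h hs b hb => ψ.red_isCandidate.step (h b hb) (.app_left _ hs)
      -- Neutrality of `a` excludes a β-step at the root; steps of the argument are absorbed by
      -- induction on its termination.
      neutral := fun {a} hn h b hb => by
        induction φ.red_isCandidate.sn hb with
        | intro b _ ih =>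
          refine ψ.red_isCandidate.neutral trivial fun c hc => ?_
          cases hc with
          | beta => exact hn.elim
          | app_left _ hs => exact h _ hs b hb
          | app_right _ hs => exact ih _ hs (φ.red_isCandidate.step hb hs) }

-- Substitution changes only the terms in a type, which `Ty.Red` does not inspect. All dependency in
-- the typing rules disappears through this fact.
@[simp] theorem Ty.red_subst (φ : Ty) (s : ℕ → Tm) : (φ.subst s).Red = φ.Red := by
  induction φ generalizing s <;> simp_all [Ty.subst, Ty.Red]

@[simp] theorem Ty.red_inst (φ : Ty) (a : Tm) : (φ.inst a).Red = φ.Red := φ.red_subst _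

@[simp] theorem Ty.red_inst₂ (φ : Ty) (a b : Tm) : (φ.inst₂ a b).Red = φ.Red := φ.red_subst _

@[simp] theorem Ty.red_weaken (φ : Ty) (k : ℕ) : (φ.weaken k).Red = φ.Red := by
  rw [Ty.weaken_eq_subst, Ty.red_subst]

theorem Ty.red_lam {φ ψ : Ty} {a : Tm} (h : ∀ b, φ.Red b → ψ.Red (a.inst b)) :
    (Ty.pi φ ψ).Red (.lam a) := by
  intro b hb
  -- The instance at a variable is reducible, hence terminating, and every step of the body induces
  -- a step of that instance.
  have ha : SN a := SN.of_map (f := fun a => a.inst (.var 0)) (fun _ _ hs => hs.subst _)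
    (ψ.red_isCandidate.sn (h _ (φ.red_isCandidate.var 0)))
  induction ha generalizing b with
  | intro a _ iha =>
    induction φ.red_isCandidate.sn hb with
    | intro b _ ihb =>
      refine ψ.red_isCandidate.neutral trivial fun c hc => ?_
      cases hc with
      | beta => exact h b hb
      | app_left _ hs =>
        cases hs with
        | lam hs =>
          exact iha _ hs (fun d hd => ψ.red_isCandidate.step (h d hd) (hs.subst _)) b hb
      | app_right _ hs => exact ihb _ hs (φ.red_isCandidate.step hb hs)

theorem Tm.subst_congr {a : Tm} {s u : ℕ → Tm} (h : ∀ n, a.Occurs n → s n = u n) :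
    a.subst s = a.subst u := by
  induction a generalizing s u with
  | lam a ih =>
    simp only [Tm.subst, Tm.lam.injEq]
    refine ih fun n hn => ?_
    cases n with
    | zero => rfl
    | succ n => simp only [liftSub, scons, h n hn]
  | _ => grind [Tm.subst, Tm.Occurs]

/-- The terms of a substitution are reducible at the types of a context. -/
def Ctx.Red (Γ : Ctx) (s : ℕ → Tm) : Prop := ∀ (n : ℕ) (φ : Ty), Γ[n]? = some φ → φ.Red (s n)

theorem Ctx.Red.cons {Γ : Ctx} {s : ℕ → Tm} (h : Γ.Red s) {φ : Ty} {a : Tm} (ha : φ.Red a) :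
    Ctx.Red (φ :: Γ) (scons a s) := by
  rintro (_ | n) ψ hψ
  · obtain rfl : φ = ψ := by simpa using hψ
    exact ha
  · exact h n ψ (by simpa using hψ)

/-- Fundamental lemma of the reducibility method. Quantifying over all reducible substitutions is
what makes the induction pass under binders. -/
theorem HasType.red {Γ : Ctx} {t : ATm} {φ : Ty} (h : HasType Γ t φ) {s : ℕ → Tm}
    (hs : Γ.Red s) : φ.Red (t.drop.subst s) := by
  induction h generalizing s with
  | var _ hn => simpa [ATm.drop, Tm.subst] using hs _ _ hn
  -- The candidate of an equality type is `SN`, and `join` has no reducts.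
  | join => exact IsCandidate.sn_cand.neutral trivial nofun
  | cast _ _ _ ih => simpa [ATm.drop] using ih hs
  -- The bound variable does not survive erasure, so any reducible term may be substituted for it; a
  -- variable is always available.
  | @slam Γ ψ φ t _ hocc ih =>
    have : (ATm.slam ψ t).drop.subst s = t.drop.subst (scons (.var 0) s) := by
      simp only [ATm.drop, Tm.rename_subst]
      refine Tm.subst_congr fun n hn => ?_
      cases n with
      | zero => exact absurd hn hocc
      | succ n => rfl
    rw [this]
    exact ih (hs.cons (ψ.red_isCandidate.var 0))
  | sapp _ _ ih _ =>
    rw [Ty.red_inst]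
    exact ih hs
  | lam _ ih =>
    refine Ty.red_lam fun b hb => ?_
    rw [Tm.subst_liftSub_inst]
    exact ih (hs.cons hb)
  | app _ _ iht ihu =>
    rw [Ty.red_inst]
    exact iht hs _ (ihu hs)
  | zero => exact NatRed.zero
  | succ _ ih => exact (ih hs).succ
  | @recNat Γ φ t u v _ _ _ ihv iht ihu =>
    rw [Ty.red_inst]
    refine φ.red_isCandidate.recNat (by simpa using iht hs)
      ((Ty.red_isCandidate _).sn (ihu hs)) (fun n r hn hr => ?_) (ihv hs)
    simpa using ihu hs n hn r (by simpa using hr)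
  | nil => exact ListRed.nil _
  | cons _ _ iht ihu => exact ListRed.cons (Ty.red_isCandidate _) (iht hs) (ihu hs)
  | @recVec Γ ψ φ l t u v _ _ _ ihv iht ihu =>
    rw [Ty.red_inst₂]
    refine φ.red_isCandidate.recVec (by simpa using iht hs)
      ((Ty.red_isCandidate _).sn (ihu hs)) (fun z w r hz hw hr => ?_) (ihv hs)
    simpa using ihu hs z (by simpa using hz) w (by simpa [Ty.Red] using hw) r (by simpa using hr)

/-- The dropped form of a typable annotated term is strongly normalizing. -/
theorem HasType.sn {Γ : Ctx} {t : ATm} {φ : Ty} (h : HasType Γ t φ) : SN t.drop := by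
  -- The identity substitution is reducible because every candidate contains the variables.
  have := φ.red_isCandidate.sn (h.red (s := Tm.var) fun n ψ _ => ψ.red_isCandidate.var n)
  rwa [Tm.subst_var] at this

/-! ### Deciding joinability of strongly normalizing terms -/

/-- The list of all one-step reducts of a term. -/
def Tm.reducts : Tm → List Tm
  | .zero | .nil | .join | .var _ => []
  | .app a b =>
    a.elim [] [] [] (fun _ => []) (fun _ _ => []) (fun c => [c.inst b]) (fun _ => [])
        (fun _ _ _ => []) (fun _ _ => []) (fun _ _ _ => []) ++
      (a.reducts.map (fun x => .app x b) ++ b.reducts.map fun x => .app a x)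
  | .lam a => a.reducts.map fun x => .lam x
  | .succ a => a.reducts.map fun x => .succ x
  | .recNat a b c =>
    c.elim [a] [] [] (fun _ => []) (fun _ _ => []) (fun _ => [])
        (fun d => [.app (.app b d) (.recNat a b d)]) (fun _ _ _ => []) (fun _ _ => [])
        (fun _ _ _ => []) ++
      (a.reducts.map (fun x => .recNat x b c) ++
        (b.reducts.map (fun x => .recNat a x c) ++ c.reducts.map fun x => .recNat a b x))
  | .cons a b => a.reducts.map (fun x => .cons x b) ++ b.reducts.map fun x => .cons a x
  | .recVec a b c =>
    c.elim [] [a] [] (fun _ => []) (fun _ _ => []) (fun _ => []) (fun _ => []) (fun _ _ _ => [])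
        (fun d e => [.app (.app (.app b d) e) (.recVec a b e)]) (fun _ _ _ => []) ++
      (a.reducts.map (fun x => .recVec x b c) ++
        (b.reducts.map (fun x => .recVec a x c) ++ c.reducts.map fun x => .recVec a b x))

theorem Step.mem_reducts {a b : Tm} (h : Step a b) : b ∈ a.reducts := by
  induction h <;> simp_all [Tm.reducts, Tm.elim]

theorem Tm.step_of_mem_reducts {a b : Tm} (h : b ∈ a.reducts) : Step a b := by
  induction a generalizing b with
  | zero | nil | join | var => simp [Tm.reducts] at h
  | lam a iha | succ a iha =>
    simp only [Tm.reducts, List.mem_map] at h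
    obtain ⟨x, hx, rfl⟩ := h
    have := iha hx
    constructor; assumption
  | cons a b iha ihb =>
    simp only [Tm.reducts, List.mem_map, List.mem_append] at h
    obtain ⟨x, hx, rfl⟩ | ⟨x, hx, rfl⟩ := h
    · exact .cons_left _ (iha hx)
    · exact .cons_right _ (ihb hx)
  | app a b iha ihb =>
    simp only [Tm.reducts, List.mem_map, List.mem_append] at h
    obtain h | ⟨x, hx, rfl⟩ | ⟨x, hx, rfl⟩ := h
    · cases a <;> simp [Tm.elim] at h
      subst h
      exact .beta _ _
    · exact .app_left _ (iha hx)
    · exact .app_right _ (ihb hx)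
  | recNat a b c iha ihb ihc =>
    simp only [Tm.reducts, List.mem_map, List.mem_append] at h
    obtain h | ⟨x, hx, rfl⟩ | ⟨x, hx, rfl⟩ | ⟨x, hx, rfl⟩ := h
    · cases c <;> simp [Tm.elim] at h <;> subst h <;> constructor
    · exact .recNat_fst _ _ (iha hx)
    · exact .recNat_snd _ _ (ihb hx)
    · exact .recNat_thd _ _ (ihc hx)
  | recVec a b c iha ihb ihc =>
    simp only [Tm.reducts, List.mem_map, List.mem_append] at h
    obtain h | ⟨x, hx, rfl⟩ | ⟨x, hx, rfl⟩ | ⟨x, hx, rfl⟩ := h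
    · cases c <;> simp [Tm.elim] at h <;> subst h <;> constructor
    · exact .recVec_fst _ _ (iha hx)
    · exact .recVec_snd _ _ (ihb hx)
    · exact .recVec_thd _ _ (ihc hx)

theorem Tm.computable_reducts_aux : Computable Tm.reducts := by
  refine Computable.wf_rec (InvImage.wf (fun a : Tm => sizeOf a) Nat.lt_wfRel.wf)
    (next := fun a => a.elim [] [] [] (fun _ => []) (fun a b => [a, b]) (fun a => [a])
      (fun a => [a]) (fun a b c => [a, b, c]) (fun a b => [a, b]) (fun a b c => [a, b, c]))
    (step := fun q => q.1.elim [] [] [] (fun _ => [])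
      (fun a b =>
        a.elim [] [] [] (fun _ => []) (fun _ _ => []) (fun c => [c.inst b]) (fun _ => [])
          (fun _ _ _ => []) (fun _ _ => []) (fun _ _ _ => []) ++
        ((q.2[0]?.getD []).map (fun x => .app x b) ++ (q.2[1]?.getD []).map fun x => .app a x))
      (fun _ => (q.2[0]?.getD []).map fun x => .lam x)
      (fun _ => (q.2[0]?.getD []).map fun x => .succ x)
      (fun a b c =>
        c.elim [a] [] [] (fun _ => []) (fun _ _ => []) (fun _ => [])
          (fun d => [.app (.app b d) (.recNat a b d)]) (fun _ _ _ => []) (fun _ _ => [])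
          (fun _ _ _ => []) ++
        ((q.2[0]?.getD []).map (fun x => .recNat x b c) ++
          ((q.2[1]?.getD []).map (fun x => .recNat a x c) ++
            (q.2[2]?.getD []).map fun x => .recNat a b x)))
      (fun a b =>
        (q.2[0]?.getD []).map (fun x => .cons x b) ++ (q.2[1]?.getD []).map fun x => .cons a x)
      (fun a b c =>
        c.elim [] [a] [] (fun _ => []) (fun _ _ => []) (fun _ => []) (fun _ => [])
          (fun _ _ _ => []) (fun d e => [.app (.app (.app b d) e) (.recVec a b e)])
          (fun _ _ _ => []) ++
        ((q.2[0]?.getD []).map (fun x => .recVec x b c) ++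
          ((q.2[1]?.getD []).map (fun x => .recVec a x c) ++
            (q.2[2]?.getD []).map fun x => .recVec a b x))))
    (by fun_prop) (by fun_prop) ?_ ?_
  · intro a
    cases a <;> simp [Tm.elim, InvImage, WellFoundedRelation.rel] <;> omega
  · intro a
    cases a <;> rfl

section Computability

variable {α β : Type} [Primcodable α] [Primcodable β]

@[fun_prop] theorem Tm.computable_reducts {f : α → Tm} (hf : Computable f) :
    Computable fun x => (f x).reducts := Tm.computable_reducts_aux.comp hf

theorem computable_iterate {f : β → β} (hf : Computable f) {n : α → ℕ} {g : α → β}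
    (hn : Computable n) (hg : Computable g) : Computable fun x => f^[n x] (g x) := by
  have : Computable fun p : α × ℕ × β => f p.2.2 := by fun_prop
  refine (Computable.nat_rec (h := fun _ p => f p.2) hn hg this).of_eq fun x => ?_
  induction n x with
  | zero => rfl
  | succ n ih => rw [Function.iterate_succ_apply', ← ih]

end Computability

/-! ### Exhaustive search of reduction graphs -/

/-- The reducts of the terms in a list. -/
def expand (l : List Tm) : List Tm := l.flatMap Tm.reducts

/-- The terms in a list together with their reducts. -/
def grow (l : List Tm) : List Tm := l ++ expand l

/-- The iterate lists the ends of all reductions of length exactly `n` starting in `l`, so it is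
empty when no single element starts such a reduction. -/
theorem iterate_expand_eq_nil_iff (n : ℕ) (l : List Tm) :
    expand^[n] l = [] ↔ ∀ a ∈ l, expand^[n] [a] = [] := by
  induction n generalizing l with
  | zero =>
    rcases l with _ | ⟨b, l⟩
    · simp
    · simpa using ⟨b, fun h => (h rfl).elim⟩
  | succ n ih =>
    simp only [Function.iterate_succ_apply]
    rw [ih]
    have h (a : Tm) := ih (expand [a])
    simp only [h]
    simp [expand]
    grind

theorem iterate_expand_eq_nil_mono {m n : ℕ} (h : m ≤ n) {l : List Tm}
    (hl : expand^[m] l = []) : expand^[n] l = [] := by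
  induction h with
  | refl => exact hl
  | step _ ih => rw [Function.iterate_succ_apply', ih]; rfl

theorem exists_forall_iterate_expand {l : List Tm} (h : ∀ a ∈ l, ∃ n, expand^[n] [a] = []) :
    ∃ n, expand^[n] l = [] := by
  choose! n hn using h
  -- The sum serves as a common upper bound for the individual depths.
  refine ⟨(l.map n).sum, (iterate_expand_eq_nil_iff _ _).2 fun a ha => ?_⟩
  exact iterate_expand_eq_nil_mono
    (List.single_le_sum (by simp) _ (List.mem_map_of_mem ha)) (hn a ha)

/-- Finite branching turns termination into a uniform bound on the length of reductions: by
induction the finitely many reducts have a common bound. -/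
theorem SN.exists_iterate_expand {a : Tm} (h : SN a) : ∃ n, expand^[n] [a] = [] := by
  induction h with
  | intro a _ ih =>
    obtain ⟨n, hn⟩ := exists_forall_iterate_expand (l := a.reducts)
      fun b hb => ih b (Tm.step_of_mem_reducts hb)
    exact ⟨n + 1, by simpa [Function.iterate_succ_apply, expand] using hn⟩

theorem iterate_grow_subset (n : ℕ) {l l' : List Tm} (h : l ⊆ l') :
    grow^[n] l ⊆ grow^[n] l' := by
  induction n generalizing l l' with
  | zero => exact h
  | succ n ih =>
    refine ih fun a ha => ?_
    simp only [grow, expand, List.mem_append, List.mem_flatMap] at ha ⊢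
    exact ha.imp (fun h' => h h') fun ⟨b, hb, hab⟩ => ⟨b, h hb, hab⟩

theorem subset_iterate_grow (n : ℕ) (l : List Tm) : l ⊆ grow^[n] l := by
  induction n with
  | zero => exact List.Subset.refl _
  | succ n ih =>
    rw [Function.iterate_succ_apply']
    exact List.Subset.trans ih (List.subset_append_left _ _)

theorem exists_of_mem_iterate_grow {n : ℕ} {l : List Tm} {c : Tm} (h : c ∈ grow^[n] l) :
    ∃ a ∈ l, Relation.ReflTransGen Step a c := by
  induction n generalizing l with
  | zero => exact ⟨c, h, .refl⟩
  | succ n ih =>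
    obtain ⟨a, ha, hac⟩ := ih h
    simp only [grow, expand, List.mem_append, List.mem_flatMap] at ha
    obtain ha | ⟨b, hb, hab⟩ := ha
    · exact ⟨a, ha, hac⟩
    · exact ⟨b, hb, .head (Tm.step_of_mem_reducts hab) hac⟩

/-- If no reduction from `l` has length `n`, then `n` rounds reach every reduct: the first step
leads into `expand l`, where one round fewer is needed. -/
theorem mem_iterate_grow {n : ℕ} {l : List Tm} (hl : expand^[n] l = []) {a c : Tm} (ha : a ∈ l)
    (h : Relation.ReflTransGen Step a c) : c ∈ grow^[n] l := by
  induction n generalizing l a with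
  | zero => simp_all
  | succ n ih =>
    obtain rfl | ⟨b, hab, hbc⟩ := h.cases_head
    · exact subset_iterate_grow _ _ ha
    · exact iterate_grow_subset n (List.subset_append_right _ _)
        (ih hl (List.mem_flatMap.2 ⟨a, ha, hab.mem_reducts⟩) hbc)

/-- The common elements of two lists. -/
def common (l l' : List Tm) : List Tm :=
  l.flatMap fun x => l'.flatMap fun y => bif x.code == y.code then [x] else []

theorem mem_common {l l' : List Tm} {a : Tm} : a ∈ common l l' ↔ a ∈ l ∧ a ∈ l' := by
  simp only [common, List.mem_flatMap]
  constructor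
  · rintro ⟨x, hx, y, hy, h⟩
    by_cases hxy : x = y
    · subst hxy
      obtain rfl : a = x := by simpa using h
      exact ⟨hx, hy⟩
    · simp [beq_false_of_ne (Tm.code_injective.ne hxy)] at h
  · rintro ⟨h, h'⟩
    exact ⟨a, h, a, h', by simp⟩

@[fun_prop] theorem computable_common {α : Type} [Primcodable α] {f g : α → List Tm}
    (hf : Computable f) (hg : Computable g) : Computable fun x => common (f x) (g x) := by
  unfold common
  fun_prop

/-- Partial decision procedure for joinability: it explores the reducts of both terms. -/
def joinTest (p : Tm × Tm) : Part Bool :=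
  (Nat.rfind fun n =>
    Part.some ((expand^[n] [p.1]).length + (expand^[n] [p.2]).length == 0)).map fun n =>
      bif (common (grow^[n] [p.1]) (grow^[n] [p.2])).length == 0 then false else true

theorem joinTest_partrec : Partrec joinTest := by
  have he : Computable expand := by unfold expand; fun_prop
  have hg : Computable grow := by unfold grow; fun_prop
  refine Partrec.map (Partrec.rfind (Computable.partrec ?_)) ?_
  · have h₁ := computable_iterate he (n := fun p : (Tm × Tm) × ℕ => p.2)
      (g := fun p => [p.1.1]) (by fun_prop) (by fun_prop)
    have h₂ := computable_iterate he (n := fun p : (Tm × Tm) × ℕ => p.2)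
      (g := fun p => [p.1.2]) (by fun_prop) (by fun_prop)
    fun_prop
  · have h₁ := computable_iterate hg (n := fun p : (Tm × Tm) × ℕ => p.2)
      (g := fun p => [p.1.1]) (by fun_prop) (by fun_prop)
    have h₂ := computable_iterate hg (n := fun p : (Tm × Tm) × ℕ => p.2)
      (g := fun p => [p.1.2]) (by fun_prop) (by fun_prop)
    have h := computable_common h₁ h₂
    refine Computable.cond_fun (f := fun _ => false) (g := fun _ => true) ?_ ?_ ?_ <;> fun_prop

-- Termination of both terms makes the search halt at a depth where both graphs are exhausted. The
-- terms are joinable precisely when the two complete lists of reducts share an element.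
open Classical in
theorem mem_joinTest {a b : Tm} (ha : SN a) (hb : SN b) :
    decide (Joinable a b) ∈ joinTest (a, b) := by
  obtain ⟨m, hm⟩ := ha.exists_iterate_expand
  obtain ⟨n, hn⟩ := hb.exists_iterate_expand
  obtain ⟨k, hk, -⟩ := Nat.rfind_min' (m := max m n)
    (p := fun n => (expand^[n] [a]).length + (expand^[n] [b]).length == 0) (by
      simp [iterate_expand_eq_nil_mono (le_max_left m n) hm,
        iterate_expand_eq_nil_mono (le_max_right m n) hn])
  refine (Part.mem_map_iff _).2 ⟨k, hk, ?_⟩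
  obtain ⟨ha', hb'⟩ : expand^[k] [a] = [] ∧ expand^[k] [b] = [] := by
    simpa using Nat.rfind_spec hk
  have key : Joinable a b ↔ ∃ c, c ∈ common (grow^[k] [a]) (grow^[k] [b]) := by
    refine exists_congr fun c => ?_
    rw [mem_common]
    constructor
    · exact fun h => ⟨mem_iterate_grow ha' (by simp) h.1, mem_iterate_grow hb' (by simp) h.2⟩
    · rintro ⟨h₁, h₂⟩
      obtain ⟨_, h, h₃⟩ := exists_of_mem_iterate_grow h₁
      obtain ⟨_, h', h₄⟩ := exists_of_mem_iterate_grow h₂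
      simp only [List.mem_singleton] at h h'
      subst h h'
      exact ⟨h₃, h₄⟩
  cases hc : common (grow^[k] [a]) (grow^[k] [b]) with
  | nil => simp [key, hc]
  | cons c l =>
    have : Joinable a b := key.2 ⟨c, by simp [hc]⟩
    simp [this]

/-! ### Type inference -/

/-- The components of a vector type. -/
def Ty.asVec : Ty → Option (Ty × Tm) :=
  Ty.elim none (fun φ a => some (φ, a)) (fun _ _ => none) (fun _ _ => none) (fun _ _ => none)

/-- The components of a product type. -/
def Ty.asPi : Ty → Option (Ty × Ty) :=
  Ty.elim none (fun _ _ => none) (fun φ ψ => some (φ, ψ)) (fun _ _ => none) (fun _ _ => none)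

/-- The components of an implicit product type. -/
def Ty.asAll : Ty → Option (Ty × Ty) :=
  Ty.elim none (fun _ _ => none) (fun _ _ => none) (fun φ ψ => some (φ, ψ)) (fun _ _ => none)

/-- The components of an equality type. -/
def Ty.asEq : Ty → Option (Tm × Tm) :=
  Ty.elim none (fun _ _ => none) (fun _ _ => none) (fun _ _ => none) (fun a b => some (a, b))

@[simp] theorem Ty.asVec_eq_some {φ : Ty} {p : Ty × Tm} :
    φ.asVec = some p ↔ φ = .vec p.1 p.2 := by
  cases φ <;> simp [asVec, elim, Prod.ext_iff]

@[simp] theorem Ty.asPi_eq_some {φ : Ty} {p : Ty × Ty} : φ.asPi = some p ↔ φ = .pi p.1 p.2 := by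
  cases φ <;> simp [asPi, elim, Prod.ext_iff]

@[simp] theorem Ty.asAll_eq_some {φ : Ty} {p : Ty × Ty} :
    φ.asAll = some p ↔ φ = .all p.1 p.2 := by
  cases φ <;> simp [asAll, elim, Prod.ext_iff]

@[simp] theorem Ty.asEq_eq_some {φ : Ty} {p : Tm × Tm} : φ.asEq = some p ↔ φ = .eq p.1 p.2 := by
  cases φ <;> simp [asEq, elim, Prod.ext_iff]

/-- Tests whether an inferred type is a given one. -/
def isTy (o : Option Ty) (φ : Ty) : Bool := (o.bind fun ψ => some (ψ.code == φ.code)).getD false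

@[simp] theorem isTy_iff {o : Option Ty} {φ : Ty} : isTy o φ = true ↔ o = some φ := by
  cases o <;> simp [isTy, Ty.code_injective.eq_iff]

/-- Tests whether the variable with index `0` is not free in a term. -/
def Tm.zeroFree (a : Tm) : Bool := (a.subst (listSub [.var 1] 1)).code == a.code

@[simp] theorem Tm.zeroFree_iff {a : Tm} : a.zeroFree = true ↔ ¬ a.Occurs 0 := by
  simp [zeroFree, Tm.code_injective.eq_iff, Tm.not_occurs_zero_iff]

/-- Tests whether a context is in order. -/
def Ctx.isOk : Ctx → Bool
  | [] => true
  | φ :: Γ => (φ.subst (liftSub^[Γ.length] (listSub [] 1))).code == φ.code && Ctx.isOk Γ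

@[simp] theorem Ctx.isOk_iff {Γ : Ctx} : Γ.isOk = true ↔ Γ.Ok := by
  induction Γ with
  | nil => simp [isOk, Ok]
  | cons φ Γ ih => simp [isOk, Ok, ih, Ty.code_injective.eq_iff, Ty.occurs_lt_iff]

open Classical in
/-- Type inference. -/
noncomputable def infer : ATm → Ctx → Option Ty
  | .zero, Γ => bif Γ.isOk then some .nat else none
  | .var n, Γ => bif Γ.isOk then Γ[n]?.bind fun φ => some (φ.weaken (n + 1)) else none
  | .app t u, Γ => ((infer t Γ).bind fun φ => φ.asPi).bind fun p =>
      bif isTy (infer u Γ) p.1 then some (p.2.inst u.drop) else none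
  | .sapp t u, Γ => ((infer t Γ).bind fun φ => φ.asAll).bind fun p =>
      bif isTy (infer u Γ) p.1 then some (p.2.inst u.drop) else none
  | .lam ψ t, Γ => (infer t (ψ :: Γ)).bind fun φ => some (.pi ψ φ)
  | .slam ψ t, Γ => (infer t (ψ :: Γ)).bind fun φ =>
      bif t.drop.zeroFree then some (.all ψ φ) else none
  | .succ t, Γ => bif isTy (infer t Γ) .nat then some .nat else none
  | .recNat φ t u v, Γ =>
      bif isTy (infer t Γ) (φ.inst .zero) && (isTy (infer u Γ) (natStepTy φ) &&
        isTy (infer v Γ) .nat) then some (φ.inst v.drop) else none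
  | .nil φ, Γ => bif Γ.isOk then some (.vec φ .zero) else none
  | .cons t u, Γ => ((infer u Γ).bind fun φ => φ.asVec).bind fun p =>
      bif isTy (infer t Γ) p.1 then some (.vec p.1 (.succ p.2)) else none
  | .recVec φ t u v, Γ => ((infer v Γ).bind fun ψ => ψ.asVec).bind fun p =>
      bif isTy (infer t Γ) (φ.inst₂ .zero .nil) && isTy (infer u Γ) (vecStepTy p.1 φ) then
        some (φ.inst₂ p.2 v.drop) else none
  -- Joinability is decided classically here. Consulting it only after both sides have types is what
  -- later allows a terminating search to replace it.
  | .join t u, Γ => (infer t Γ).bind fun _ => (infer u Γ).bind fun _ =>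
      bif decide (Joinable t.drop u.drop) then some (.eq t.drop u.drop) else none
  | .cast φ t u, Γ => ((infer t Γ).bind fun ψ => ψ.asEq).bind fun p =>
      bif isTy (infer u Γ) (φ.inst p.1) then some (φ.inst p.2) else none

/-- Unfolding a successful call yields precisely the premises of the one rule for its constructor.
-/
theorem hasType_of_infer {t : ATm} {Γ : Ctx} {φ : Ty} (h : infer t Γ = some φ) :
    HasType Γ t φ := by
  induction t generalizing Γ φ <;>
    simp only [infer, Option.bind_eq_some_iff, cond_eq_ite, Option.ite_none_right_eq_some,
      isTy_iff, Ctx.isOk_iff, Tm.zeroFree_iff, Bool.and_eq_true, Option.some.injEq,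
      Ty.asPi_eq_some, Ty.asAll_eq_some, Ty.asVec_eq_some, Ty.asEq_eq_some,
      decide_eq_true_eq] at h
  case zero => obtain ⟨h, rfl⟩ := h; exact .zero h
  case var => obtain ⟨h, ψ, hψ, rfl⟩ := h; exact .var h hψ
  case app iht ihu =>
    obtain ⟨p, ⟨_, ht, rfl⟩, hu, rfl⟩ := h
    exact .app (iht ht) (ihu hu)
  case sapp iht ihu =>
    obtain ⟨p, ⟨_, ht, rfl⟩, hu, rfl⟩ := h
    exact .sapp (iht ht) (ihu hu)
  case lam ih => obtain ⟨ψ, h, rfl⟩ := h; exact .lam (ih h)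
  case slam ih => obtain ⟨ψ, h, h', rfl⟩ := h; exact .slam (ih h) h'
  case succ ih => obtain ⟨h, rfl⟩ := h; exact .succ (ih h)
  case recNat iht ihu ihv =>
    obtain ⟨⟨ht, hu, hv⟩, rfl⟩ := h
    exact .recNat (ihv hv) (iht ht) (ihu hu)
  case nil => obtain ⟨h, rfl⟩ := h; exact .nil h
  case cons iht ihu =>
    obtain ⟨p, ⟨_, hu, rfl⟩, ht, rfl⟩ := h
    exact .cons (iht ht) (ihu hu)
  case recVec iht ihu ihv =>
    obtain ⟨p, ⟨_, hv, rfl⟩, ⟨ht, hu⟩, rfl⟩ := h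
    exact .recVec (ihv hv) (iht ht) (ihu hu)
  case join iht ihu =>
    obtain ⟨_, ht, _, hu, hj, rfl⟩ := h
    exact .join (iht ht) (ihu hu) hj
  case cast iht ihu =>
    obtain ⟨p, ⟨_, ht, rfl⟩, hu, rfl⟩ := h
    exact .cast (iht ht) (ihu hu)

/-- Completeness, which also contains uniqueness of types: the types inferred for the premises are
the ones in the derivation, so every test succeeds. -/
theorem HasType.infer_eq {Γ : Ctx} {t : ATm} {φ : Ty} (h : HasType Γ t φ) :
    infer t Γ = some φ := by
  induction h <;>
    simp_all [infer, cond_eq_ite, Ty.asPi, Ty.asAll, Ty.asVec, Ty.asEq,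
      Ty.elim, -isTy_iff, isTy]

/-! ### Computability of type inference -/

theorem ATm.computable_drop_aux : Computable ATm.drop := by
  refine Computable.wf_rec (InvImage.wf (fun a : ATm => sizeOf a) Nat.lt_wfRel.wf)
    (next := fun t => t.elim [] (fun _ => []) (fun t u => [t, u]) (fun t _ => [t])
      (fun _ t => [t]) (fun _ t => [t]) (fun t => [t]) (fun _ t u v => [t, u, v]) (fun _ => [])
      (fun t u => [t, u]) (fun _ t u v => [t, u, v]) (fun _ _ => []) (fun _ _ u => [u]))
    (step := fun q : ATm × List Tm => q.1.elim .zero (fun n => .var n)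
      (fun _ _ => .app (q.2[0]?.getD Tm.nil) (q.2[1]?.getD Tm.nil))
      (fun _ _ => q.2[0]?.getD Tm.nil)
      (fun _ _ => .lam (q.2[0]?.getD Tm.nil))
      (fun _ _ => (q.2[0]?.getD Tm.nil).subst (listSub [.var 0] 0))
      (fun _ => .succ (q.2[0]?.getD Tm.nil))
      (fun _ _ _ _ => .recNat (q.2[0]?.getD Tm.nil) (q.2[1]?.getD Tm.nil) (q.2[2]?.getD Tm.nil))
      (fun _ => .nil)
      (fun _ _ => .cons (q.2[0]?.getD Tm.nil) (q.2[1]?.getD Tm.nil))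
      (fun _ _ _ _ => .recVec (q.2[0]?.getD Tm.nil) (q.2[1]?.getD Tm.nil) (q.2[2]?.getD Tm.nil))
      (fun _ _ => .join) (fun _ _ _ => q.2[0]?.getD Tm.nil))
    (by fun_prop) (by fun_prop) ?_ ?_
  · intro a
    cases a <;> simp [ATm.elim, InvImage, WellFoundedRelation.rel] <;> omega
  · intro a
    cases a <;> simp [ATm.elim, ATm.drop, Tm.rename_pred]

theorem Ctx.computable_isOk_aux : Computable Ctx.isOk := by
  have hn : Computable fun Γ : Ctx =>
      List.casesOn (motive := fun _ => List Ctx) Γ [] fun _ Γ => [Γ] :=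
    Computable.list_elim_fun Computable.id (Computable.const _) (by fun_prop)
  have hk : Computable fun p : (Ctx × List Bool) × Ty × List Ty =>
      p.2.1.subst (liftSub^[p.2.2.length] (listSub [] 1)) :=
    Ty.computable_subst (l := fun _ => []) (d := fun _ => 1) (by fun_prop) (by fun_prop)
      (by fun_prop) (by fun_prop)
  have hs : Computable fun q : Ctx × List Bool =>
      List.casesOn (motive := fun _ => Bool) q.1 true fun φ Γ =>
        (φ.subst (liftSub^[Γ.length] (listSub [] 1))).code == φ.code && (q.2[0]?.getD false) :=
    Computable.list_elim_fun Computable.fst (Computable.const _)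
      (.and_fun (.beq_fun (Ty.computable_code hk) (by fun_prop)) (by fun_prop))
  refine Computable.wf_rec (InvImage.wf (fun Γ : Ctx => Γ.length) Nat.lt_wfRel.wf) hn hs ?_ ?_
  · rintro (_ | ⟨φ, Γ⟩) <;> simp [InvImage, WellFoundedRelation.rel]
  · rintro (_ | ⟨φ, Γ⟩) <;> simp [Ctx.isOk]

section Computability

variable {α : Type} [Primcodable α]

@[fun_prop] theorem ATm.computable_drop {f : α → ATm} (hf : Computable f) :
    Computable fun x => (f x).drop := ATm.computable_drop_aux.comp hf

@[fun_prop] theorem Ctx.computable_isOk {f : α → Ctx} (hf : Computable f) :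
    Computable fun x => Ctx.isOk (f x) := Ctx.computable_isOk_aux.comp hf

@[fun_prop] theorem Ty.computable_asVec {f : α → Ty} (hf : Computable f) :
    Computable fun x => (f x).asVec := by unfold asVec; fun_prop

@[fun_prop] theorem Ty.computable_asPi {f : α → Ty} (hf : Computable f) :
    Computable fun x => (f x).asPi := by unfold asPi; fun_prop

@[fun_prop] theorem Ty.computable_asAll {f : α → Ty} (hf : Computable f) :
    Computable fun x => (f x).asAll := by unfold asAll; fun_prop

@[fun_prop] theorem Ty.computable_asEq {f : α → Ty} (hf : Computable f) :
    Computable fun x => (f x).asEq := by unfold asEq; fun_prop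

@[fun_prop] theorem computable_isTy {f : α → Option Ty} {g : α → Ty} (hf : Computable f)
    (hg : Computable g) : Computable fun x => isTy (f x) (g x) := by unfold isTy; fun_prop

@[fun_prop] theorem Tm.computable_zeroFree {f : α → Tm} (hf : Computable f) :
    Computable fun x => (f x).zeroFree := by unfold zeroFree; fun_prop

end Computability

/-- The joinability problem that has to be solved to infer the type of a term, if the types of
the immediate subterms are given. -/
def joinProblem (q : (Ctx × ATm) × List (Option Ty)) : Option (Tm × Tm) :=
  q.1.2.elim none (fun _ => none) (fun _ _ => none) (fun _ _ => none) (fun _ _ => none)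
    (fun _ _ => none) (fun _ => none) (fun _ _ _ _ => none) (fun _ => none) (fun _ _ => none)
    (fun _ _ _ _ => none)
    (fun t u => (q.2[0]?.getD none).bind fun _ => (q.2[1]?.getD none).bind fun _ =>
      some (t.drop, u.drop))
    (fun _ _ _ => none)

/-- The type of a term, given the types of the immediate subterms and the solution of the
joinability problem. -/
def inferStep (q : ((Ctx × ATm) × List (Option Ty)) × Bool) : Option Ty :=
  q.1.1.2.elim
    (bif Ctx.isOk q.1.1.1 then some .nat else none)
    (fun n =>
      bif Ctx.isOk q.1.1.1 then q.1.1.1[n]?.bind fun φ => some (φ.weaken (n + 1)) else none)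
    (fun _ u => ((q.1.2[0]?.getD none).bind fun φ => φ.asPi).bind fun p =>
      bif isTy (q.1.2[1]?.getD none) p.1 then some (p.2.inst u.drop) else none)
    (fun _ u => ((q.1.2[0]?.getD none).bind fun φ => φ.asAll).bind fun p =>
      bif isTy (q.1.2[1]?.getD none) p.1 then some (p.2.inst u.drop) else none)
    (fun ψ _ => (q.1.2[0]?.getD none).bind fun φ => some (.pi ψ φ))
    (fun ψ t => (q.1.2[0]?.getD none).bind fun φ =>
      bif t.drop.zeroFree then some (.all ψ φ) else none)
    (fun _ => bif isTy (q.1.2[0]?.getD none) .nat then some .nat else none)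
    (fun φ _ _ v =>
      bif isTy (q.1.2[0]?.getD none) (φ.inst .zero) &&
        (isTy (q.1.2[1]?.getD none) (natStepTy φ) && isTy (q.1.2[2]?.getD none) .nat) then
        some (φ.inst v.drop) else none)
    (fun φ => bif Ctx.isOk q.1.1.1 then some (.vec φ .zero) else none)
    (fun _ _ => ((q.1.2[1]?.getD none).bind fun φ => φ.asVec).bind fun p =>
      bif isTy (q.1.2[0]?.getD none) p.1 then some (.vec p.1 (.succ p.2)) else none)
    (fun φ _ _ v => ((q.1.2[2]?.getD none).bind fun ψ => ψ.asVec).bind fun p =>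
      bif isTy (q.1.2[0]?.getD none) (φ.inst₂ .zero .nil) &&
        isTy (q.1.2[1]?.getD none) (vecStepTy p.1 φ) then
        some (φ.inst₂ p.2 v.drop) else none)
    (fun t u => (q.1.2[0]?.getD none).bind fun _ => (q.1.2[1]?.getD none).bind fun _ =>
      bif q.2 then some (.eq t.drop u.drop) else none)
    (fun φ _ _ => ((q.1.2[0]?.getD none).bind fun ψ => ψ.asEq).bind fun p =>
      bif isTy (q.1.2[1]?.getD none) (φ.inst p.1) then some (φ.inst p.2) else none)

theorem computable_joinProblem : Computable joinProblem := by
  unfold joinProblem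
  fun_prop

theorem computable_inferStep : Computable inferStep := by
  unfold inferStep
  fun_prop

-- The recursion is on the size of the term, with the context in the argument because binders extend
-- it. The step function is partial, since `joinTest` may diverge on arbitrary terms, but it has a
-- value wherever the recursion calls it.
open Classical in
theorem computable_infer : Computable fun p : Ctx × ATm => infer p.2 p.1 := by
  refine Partrec.wf_rec (InvImage.wf (fun p : Ctx × ATm => sizeOf p.2) Nat.lt_wfRel.wf)
    (next := fun p => p.2.elim [] (fun _ => []) (fun t u => [(p.1, t), (p.1, u)])
      (fun t u => [(p.1, t), (p.1, u)]) (fun ψ t => [(ψ :: p.1, t)]) (fun ψ t => [(ψ :: p.1, t)])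
      (fun t => [(p.1, t)]) (fun _ t u v => [(p.1, t), (p.1, u), (p.1, v)]) (fun _ => [])
      (fun t u => [(p.1, t), (p.1, u)]) (fun _ t u v => [(p.1, t), (p.1, u), (p.1, v)])
      (fun t u => [(p.1, t), (p.1, u)]) (fun _ t u => [(p.1, t), (p.1, u)]))
    (step := fun q => Part.map (fun b => inferStep (q, b))
      -- Without a joinability problem the Boolean is a dummy: `inferStep` uses it only for a `join`
      -- whose two sides have types.
      (Option.casesOn (motive := fun _ => Part Bool) (joinProblem q) (Part.some false) joinTest))
    (by fun_prop) ?_ ?_ ?_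
  · refine Partrec.map (Partrec.optionCasesOn_right computable_joinProblem (Computable.const _)
      (joinTest_partrec.comp Computable.snd)) ?_
    exact computable_inferStep
  · rintro ⟨Γ, t⟩
    cases t <;> simp [ATm.elim, InvImage, WellFoundedRelation.rel] <;> omega
  · rintro ⟨Γ, t⟩
    cases t
    case join t u =>
      cases ht : infer t Γ with
      | none => simp [ATm.elim, infer, joinProblem, inferStep, ht]
      | some φ =>
        cases hu : infer u Γ with
        | none => simp [ATm.elim, infer, joinProblem, inferStep, ht, hu]
        | some ψ =>
          refine (Part.mem_map_iff _).2 ⟨decide (Joinable t.drop u.drop), ?_, ?_⟩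
          -- Both sides have inferred types, so by soundness they are typable, their erasures
          -- terminate, and the search halts with the right answer.
          · simpa [ATm.elim, joinProblem, ht, hu] using
              mem_joinTest (hasType_of_infer ht).sn (hasType_of_infer hu).sn
          · simp [ATm.elim, infer, inferStep, ht, hu]
    all_goals simp [ATm.elim, infer, joinProblem, inferStep]

end Tvec

theorem mainTheorem8 :
    ∃ infer : Tvec.Ctx × Tvec.ATm → Option Tvec.Ty,
      Computable infer ∧
      ∀ (Γ : Tvec.Ctx) (t : Tvec.ATm),
        (∀ φ : Tvec.Ty, infer (Γ, t) = some φ → Tvec.HasType Γ t φ) ∧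
        (infer (Γ, t) = none → ¬ ∃ φ : Tvec.Ty, Tvec.HasType Γ t φ) := by
  refine ⟨_, Tvec.computable_infer, fun Γ t => ⟨fun φ h => Tvec.hasType_of_infer h, ?_⟩⟩
  rintro h ⟨φ, hφ⟩
  simp [hφ.infer_eq] at h
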